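/- **Setting.** Let $\alpha>\frac12$ and let $M,N$ be positive integers. The (multi-species) half-line open TASEP with reservoir rate $\alpha$ is the continuous-time Markov process on configurations $\eta\in\{1,2,3,+\infty\}^{\{1,2,3,\dots\}}$ (classes of particles $1,2,3$; $+\infty$ is a hole) with the following dynamics: for each $x\ge1$, the contents of sites $x$ and $x+1$ are exchanged at rate $1$ if $\eta(x)<\eta(x+1)$; and at rate $\alpha$ the content of site $1$ is replaced by a first class particle if $\eta(1)>1$. Let * $\eta^{\mathrm{step}}_t$ be this process started from the configuration with only holes; * $\xi_t$ be this process started from $\xi_0(x)=1$ for $N+1\le x\le N+M$ and for $N+2M+2\le x\le 2N+2M+1$, $\xi_0(N+2M+1)=2$, and $\xi_0(x)=+\infty$ otherwise; $g(t)$ is the position of the unique second class particle of $\xi_t$, with $g(t)=-1$ once it has been replaced at site $1$, so that $\{g(t)>0\}$ is the event that it is still in the system; * $\tilde\xi_t$ be this process started from $\tilde\xi_0(x)=2$ for $N+1\le x\le N+M$, $\tilde\xi_0(x)=3$ for $N+2M+1\le x\le 2N+2M+1$, and $\tilde\xi_0(x)=+\infty$ otherwise; $\mathsf N_3(1,t)$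 is the number of third class particles of $\tilde\xi_t$ at sites $\ge1$. **Assumption (the conjecture).** As $t\to\infty$, the occupation variables of $\eta^{\mathrm{step}}_t$ converge in distribution to the probability measure $\mu$ on $\{0,1\}^{\{1,2,\dots\}}$ with $$\mu\{\zeta:\zeta_1=\eta_1,\dots,\zeta_L=\eta_L\}=\langle w|\prod_{x=1}^{L}\bigl(\eta_xD+(1-\eta_x)E\bigr)|v\rangle\qquad(L\in\mathbb N,\ \eta\in\{0,1\}^L),$$ where $D,E$ are non-negative matrices and $\langle w|,|v\rangle$ vectors with $DE=c(D+E)$, $\alpha\langle w|E=c\langle w|$, $(D+E)|v\rangle=|v\rangle$, $\langle w|v\rangle=1$ and $c=\frac14$. **DEHP-tree.** For $\eta\in\{0,1\}^L$ let $A$ be the number of clusters (maximal runs) of $1$'s, $\sigma_j$ ($1\le j\le A$) the number of $1$'s in the $j$-th cluster, and $\tau_j$ ($0\le j\le A$) the number of $0$'s after the $j$-th cluster and before the $(j+1)$-th (for $j=0$: before the first cluster; for $j=A$: after the last one). Put $\Psi_i=\sum_{j=i}^A\sigma_j$ for $1\le i\le A+1$ and $\Phi_j=\sum_{k=j}^A\tau_k$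 for $0\le j\le A+1$. The DEHP-tree of $\eta$ has root $(\Psi_1,\Phi_0)$. A node $(x,y)$ has one child $(x,y-1)$, joined by an edge of weight $c/\alpha$, if for some $1\le i\le A+1$, $x=\Psi_i$ and $\Phi_i<y\le\Phi_{i-1}$. It has two children $(x,y-1)$ and $(x-1,y)$, each joined by an edge of weight $c$, if for some $1\le i\le A$, $1\le y\le\Phi_i$ and $\Psi_{i+1}<x\le\Psi_i$. Let $Z_k(\eta)$ be the sum, over the directed paths from the root to the node $(k,0)$, of the products of the edge weights along the path, and set $$p_\alpha(\eta)=\sum_{k=0}^{\Psi_1(\eta)}\frac{Z_k(\eta)}{2^k}\left(1+\frac{\alpha-\frac12}{\alpha}k\right).$$ Let $B_{m,n}=\{\eta\in\{0,1\}^{2M+2N+1}:\sum_{i=1}^{M+N}\eta_i=m,\ \sum_{j=M+N+1}^{2M+2N+1}\eta_j=n\}$. **Theorem.** Under the assumption above, $$\lim_{t\to\infty}\mathbb P(g(t)>0)=\sum_{m=0}^{N-1}\sum_{n=0}^{M+N-m}\sum_{\eta\in B_{m,n}}p_\alpha(\eta)+\sum_{m=N}^{M+N}\sum_{n=0}^{M}\sum_{\eta\in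 B_{m,n}}p_\alpha(\eta),$$ and, for every integer $0\le s\le N$, $$\lim_{t\to\infty}\mathbb P(\mathsf N_3(1,t)=s)=\sum_{n=1}^{s}\ \sum_{\eta\in B_{N-n,\,M+N+1-s+n}}p_\alpha(\eta)+\sum_{m=N}^{M+N}\ \sum_{\eta\in B_{m,\,M+N+1-s}}p_\alpha(\eta).$$ -/

import Mathlib

open MeasureTheory Filter Topology
open scoped NNReal

noncomputable section

namespace HalfLineTASEP

/-! ### Configurations and dynamics -/

/-- The colors `1 < 2 < 3 < +∞`; `hole` plays the role of `+∞`. -/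
inductive Color
  | first
  | second
  | third
  | hole

/-- The position of a color in the order `1 < 2 < 3 < +∞`. -/
def Color.rank : Color → ℕ
  | .first => 1
  | .second => 2
  | .third => 3
  | .hole => 4

theorem Color.rank_injective : Function.Injective Color.rank := by
  intro a b h
  cases a <;> cases b <;> simp_all [Color.rank]

instance : LinearOrder Color := LinearOrder.lift' Color.rank Color.rank_injective

instance : MeasurableSpace Color := ⊤

/-- Configurations on the half-line `{1, 2, 3, …}`: the color at site `x + 1` is `η x`. -/
abbrev Config := ℕ → Color

/-- The configuration after exchanging the contents of the sites `x + 1` and `x + 2`. -/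
def exchange (η : Config) (x : ℕ) : Config := fun y => η (Equiv.swap x (x + 1) y)

/-- The configuration after placing a first class particle at site `1`. -/
def create (η : Config) : Config := Function.update η 0 Color.first

/-- The generator of the multi-species half-line open TASEP on functions of finitely many sites
(for which only finitely many terms of the sum are nonzero): across every bond a color jumps to
the right at rate `1` if the color on its right is larger, and a first class particle enters at
site `1` at rate `α`, replacing whatever is there, if the color at site `1` is larger than `1`. -/
def generator (α : ℝ) (f : Config → ℝ) (η : Config) : ℝ :=
  (if Color.first < η 0 then α * (f (create η) - f η) else 0) +
    ∑' x : ℕ, if η x < η (x + 1) then f (exchange η x) - f η else 0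

/-- `f` is a function of finitely many sites. -/
def IsLocal (f : Config → ℝ) : Prop := ∃ n : ℕ, DependsOn f (Set.Iio n)

/-- `X` is a half-line open TASEP with reservoir rate `α` started from `η₀`: a càdlàg process
solving the (well-posed) martingale problem of the generator. The martingale property may hold
with respect to any filtration to which the process is adapted, e.g. the natural one. -/
structure IsTASEP {Ω : Type*} [m : MeasurableSpace Ω] (P : Measure Ω) (α : ℝ) (η₀ : Config)
    (X : ℝ≥0 → Ω → Config) : Prop where
  /-- The process starts from `η₀`. -/
  initial : ∀ ω, X 0 ω = η₀
  /-- The color at each site is right-continuous in time. -/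
  right_continuous : ∀ ω x t, ∀ᶠ s in 𝓝[>] t, X s ω x = X t ω x
  /-- The color at each site has left limits in time. -/
  left_limit : ∀ ω x t, ∃ c : Color, ∀ᶠ s in 𝓝[<] t, X s ω x = c
  /-- The martingale problem. -/
  martingale : ∃ ℱ : Filtration ℝ≥0 m, (∀ t, Measurable[ℱ t] (X t)) ∧
    ∀ f : Config → ℝ, IsLocal f →
      Martingale (fun (t : ℝ≥0) ω => f (X t ω) - f (X 0 ω) -
        ∫ s in (0 : ℝ)..t, generator α f (X s.toNNReal ω)) ℱ P

/-! ### Initial conditions and observables -/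

/-- The step initial condition: no particles on the half-line. -/
def stepInit : Config := fun _ => Color.hole

/-- The first two-shock initial condition, with `z = i + 1` the site. -/
def twoShockInit (M N : ℕ) : Config := fun i =>
  let z := i + 1
  if N + 1 ≤ z ∧ z ≤ N + M then Color.first
  else if z = N + 2 * M + 1 then Color.second
  else if N + 2 * M + 2 ≤ z ∧ z ≤ 2 * N + 2 * M + 1 then Color.first
  else Color.hole

/-- The second two-shock initial condition, with `z = i + 1` the site. -/
def twoShockInit' (M N : ℕ) : Config := fun i =>
  let z := i + 1
  if N + 1 ≤ z ∧ z ≤ N + M then Color.second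
  else if N + 2 * M + 1 ≤ z ∧ z ≤ 2 * N + 2 * M + 1 then Color.third
  else Color.hole

open Classical in
/-- The position (site number) of the second class particle, and `-1` once it has disappeared
from the system. The processes this is applied to have at most one second class particle. -/
def secondClassPosition (η : Config) : ℤ :=
  if ∃ i, η i = Color.second then ((sInf {i : ℕ | η i = Color.second} : ℕ) : ℤ) + 1 else -1

/-- The number of particles of color `c` at sites weakly to the right of `x`. -/
def countRight (c : Color) (x : ℕ) (η : Config) : ℕ∞ :=
  Set.encard {i : ℕ | x ≤ i + 1 ∧ η i = c}

/-- The occupation variables of a configuration: `1` at particles and `0` at holes. -/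
def occupation (η : Config) : ℕ → Fin 2 := fun i => if η i = Color.hole then 0 else 1

/-! ### The matrix product measure -/

/-- Nonnegative matrices `D`, `E` (positive operators on an ordered vector space `V`), a row
vector `w` and a column vector `v` with `DE = c(D + E)`, `α wE = c w`, `(D + E)v = v` and
`wv = 1`, where `c = 1/4`. -/
structure MatrixAnsatz (α : ℝ) (V : Type) [AddCommGroup V] [PartialOrder V]
    [IsOrderedAddMonoid V] [Module ℝ V] [IsOrderedModule ℝ V] where
  D : Module.End ℝ V
  E : Module.End ℝ V
  w : V →ₗ[ℝ] ℝ
  v : V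
  D_nonneg : ∀ u, 0 ≤ u → 0 ≤ D u
  E_nonneg : ∀ u, 0 ≤ u → 0 ≤ E u
  D_mul_E : D * E = (1 / 4 : ℝ) • (D + E)
  w_E : ∀ u, α * w (E u) = 1 / 4 * w u
  D_add_E : (D + E) v = v
  w_v : w v = 1

/-- The matrix product `w (∏ₓ (ηₓ D + (1 - ηₓ) E)) v`, factors ordered from left to right. -/
def MatrixAnsatz.bracket {α : ℝ} {V : Type} [AddCommGroup V] [PartialOrder V]
    [IsOrderedAddMonoid V] [Module ℝ V] [IsOrderedModule ℝ V] (R : MatrixAnsatz α V)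
    {L : ℕ} (η : Fin L → Fin 2) : ℝ :=
  R.w ((List.ofFn fun i => if η i = 1 then R.D else R.E).prod R.v)

/-- `μ` is the measure on `{0,1}^ℕ` whose cylinder probabilities are given by the matrix product
ansatz. -/
def IsMatrixProductMeasure (α : ℝ) (μ : Measure (ℕ → Fin 2)) : Prop :=
  ∀ (V : Type) [AddCommGroup V] [PartialOrder V] [IsOrderedAddMonoid V] [Module ℝ V]
    [IsOrderedModule ℝ V] (R : MatrixAnsatz α V) (L : ℕ) (η : Fin L → Fin 2),
    μ.real {ζ | ∀ i : Fin L, ζ i = η i} = R.bracket η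

/-- The occupation variables of the process `X` converge in distribution, as `t → ∞`, to the
probability measure given by the matrix product ansatz. -/
def ConvergesToMatrixProduct {Ω : Type*} [MeasurableSpace Ω] (P : Measure Ω)
    [IsProbabilityMeasure P] (α : ℝ) (X : ℝ≥0 → Ω → Config) : Prop :=
  ∃ (μ : Measure (ℕ → Fin 2)) (_ : IsProbabilityMeasure μ), IsMatrixProductMeasure α μ ∧
    TendstoInDistribution (fun t ω => occupation (X t ω)) atTop
      (id : (ℕ → Fin 2) → (ℕ → Fin 2)) (fun _ => P) μ

/-! ### The DEHP-tree -/

section Tree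

variable {L : ℕ}

/-- The first positions of the clusters of `1`s. -/
def clusterStarts (η : Fin L → Fin 2) : Finset (Fin L) :=
  {i | η i = 1 ∧ ∀ j : Fin L, (j : ℕ) + 1 = i → η j = 0}

/-- The number of clusters of `1`s. -/
def numClusters (η : Fin L → Fin 2) : ℕ := (clusterStarts η).card

/-- The number of clusters of `1`s that start weakly to the left of `i`. Thus the `j`-th cluster of
`1`s consists of the `1`s at which this is `j`, and the zeros between the `j`-th and the
`(j+1)`-th cluster (before the first one for `j = 0`, after the last one for
`j = numClusters η`) are the zeros at which this is `j`. -/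
def clusterIndex (η : Fin L → Fin 2) (i : Fin L) : ℕ :=
  ((clusterStarts η).filter (· ≤ i)).card

/-- The number `σ_j` of `1`s in the `j`-th cluster of `1`s. -/
def numOnes (η : Fin L → Fin 2) (j : ℕ) : ℕ :=
  (Finset.univ.filter fun i => η i = 1 ∧ clusterIndex η i = j).card

/-- The number `τ_j` of `0`s between the `j`-th and the `(j+1)`-th cluster of `1`s. -/
def numZeros (η : Fin L → Fin 2) (j : ℕ) : ℕ :=
  (Finset.univ.filter fun i => η i = 0 ∧ clusterIndex η i = j).card

/-- `Ψ_i(η) = σ_i + ⋯ + σ_A`. -/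
def Psi (η : Fin L → Fin 2) (i : ℕ) : ℕ := ∑ j ∈ Finset.Icc i (numClusters η), numOnes η j

/-- `Φ_j(η) = τ_j + ⋯ + τ_A`. -/
def Phi (η : Fin L → Fin 2) (j : ℕ) : ℕ := ∑ k ∈ Finset.Icc j (numClusters η), numZeros η k

/-- The nodes `(x, y)` with one child `(x, y - 1)`. -/
def OneChild (η : Fin L → Fin 2) (x y : ℕ) : Prop :=
  ∃ i, 1 ≤ i ∧ i ≤ numClusters η + 1 ∧ x = Psi η i ∧ Phi η i < y ∧ y ≤ Phi η (i - 1)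

/-- The nodes `(x, y)` with two children `(x, y - 1)` and `(x - 1, y)`. -/
def TwoChildren (η : Fin L → Fin 2) (x y : ℕ) : Prop :=
  (∃ i, 1 ≤ i ∧ i ≤ numClusters η ∧ x = Psi η i ∧ 1 ≤ y ∧ y ≤ Phi η i) ∨
    ∃ i, 1 ≤ i ∧ i ≤ numClusters η ∧ Psi η (i + 1) < x ∧ x < Psi η i ∧ 1 ≤ y ∧ y ≤ Phi η i

/-- The directed paths of the DEHP-tree of `η` from the root `(Ψ₁, Φ₀)` to the node `(x, y)`. -/
inductive TreePath (η : Fin L → Fin 2) : ℕ → ℕ → Type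
  | root : TreePath η (Psi η 1) (Phi η 0)
  | only {x y : ℕ} (p : TreePath η x (y + 1)) (h : OneChild η x (y + 1)) : TreePath η x y
  | left {x y : ℕ} (p : TreePath η x (y + 1)) (h : TwoChildren η x (y + 1)) : TreePath η x y
  | right {x y : ℕ} (p : TreePath η (x + 1) y) (h : TwoChildren η (x + 1) y) : TreePath η x y

/-- The weight of a path: a factor `c/α` for the edge to an only child and a factor `c` for any
other edge, where `c = 1/4`. -/
def TreePath.weight (α : ℝ) {η : Fin L → Fin 2} : {x y : ℕ} → TreePath η x y → ℝ
  | _, _, .root => 1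
  | _, _, .only p _ => p.weight α * (1 / 4 / α)
  | _, _, .left p _ => p.weight α * (1 / 4)
  | _, _, .right p _ => p.weight α * (1 / 4)

/-- The partition function `Z_{x,y}(η)`: the sum of the weights of the (finitely many) paths from
the root to `(x, y)`. -/
def partitionFunction (α : ℝ) (η : Fin L → Fin 2) (x y : ℕ) : ℝ :=
  ∑ᶠ p : TreePath η x y, p.weight α

/-- `∑ₖ Z_k(η) 2⁻ᵏ (1 + (α - 1/2) k / α)`, where `k` runs from `0` to `Ψ₁(η)` and
`Z_k = Z_{k,0}`. -/
def treeFormula (α : ℝ) (η : Fin L → Fin 2) : ℝ :=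
  ∑ k ∈ Finset.range (Psi η 1 + 1),
    partitionFunction α η k 0 / 2 ^ k * (1 + (α - 1 / 2) / α * k)

end Tree

/-- The class `B_{m,n}` of words of length `2M + 2N + 1` with `m` ones among the first `M + N`
letters and `n` ones among the last `M + N + 1` letters. -/
def wordClass (M N m n : ℕ) : Finset (Fin (2 * M + 2 * N + 1) → Fin 2) :=
  {η | ∑ i ∈ {i : Fin (2 * M + 2 * N + 1) | (i : ℕ) < M + N}, (η i : ℕ) = m ∧
    ∑ i ∈ {i : Fin (2 * M + 2 * N + 1) | M + N ≤ (i : ℕ)}, (η i : ℕ) = n}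

end HalfLineTASEP

end

open HalfLineTASEP

noncomputable section

namespace HalfLineTASEP

/-! ### Vanishing of functions with controlled iterated derivatives -/

/-! The dynamics can be pictured as a random word in the generators of the 0-Hecke monoid of type B:
letter `0` is the reservoir, with rate `α`, and letter `x + 1` sorts a bond, with rate `1`.
Reversing the word preserves its law and exchanges colors with positions (`act_reverse_stepInit`):
if every site starts with its own color, color `j + 1` survives a word exactly when the reversed
word, run on the empty half-line, leaves site `j` empty.

Both two-shock configurations arise from configurations with weakly increasing classes through one
fixed word `shockWord`, a product of three interval sorts. Hence the number of particles of a class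
at time `t` has the law of the number of holes in a fixed set of sites after the reversed
`shockWord` has acted on the step process at time `t` (`real_encard_eq_real_card`). The reversed
word sorts two blocks and then a window overlapping both, so the outcome depends only on the
particle numbers in the two blocks; this is where the classes `wordClass M N m n` come from.

No random word is constructed. The iterated generators of the two observables agree on the initial
configurations, because appending and prepending letters commute
(`iterate_generator_eq_of_reverse`). The `k`-th time derivatives of the expectations are at most `C
* R ^ k * k!`, so `eq_zero_of_iterated_integral` gives equality at all times. The number of
particles of a class is not a function of finitely many sites; the Kolmogorov equation is therefore
extended to `Admissible` functions by truncation and finite speed of propagation.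

In the limit the block statistics of the step process are matrix products. Moving `D` to the right
past `E` by `DE = c(D + E)`, and absorbing a leading `E` into `w`, expands a word along its
DEHP-tree (`bracket_eq_sum_partitionFunction`). The leaf values `w D ^ k v` are computed in the
explicit `bidiagonalAnsatz`. -/

theorem abs_le_of_iterated_integral {ψ : ℕ → ℝ → ℝ} {C R a : ℝ}
    (hint : ∀ k t, a ≤ t → ψ k t = ψ k a + ∫ u in a..t, ψ (k + 1) u)
    (hb : ∀ k t, a ≤ t → |ψ k t| ≤ C * R ^ k * k.factorial) (h0 : ∀ k, ψ k a = 0) (m : ℕ) :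
    ∀ k t, a ≤ t →
      |ψ k t| ≤ C * R ^ (k + m) * (k + m).factorial * ((t - a) ^ m / m.factorial) := by
  induction m with
  | zero => intro k t ht; simpa using hb k t ht
  | succ m ih =>
    intro k t ht
    rw [hint k t ht, h0, zero_add]
    set K : ℝ := C * R ^ (k + 1 + m) * (k + 1 + m).factorial
    have h1 : ‖∫ u in a..t, ψ (k + 1) u‖ ≤ ∫ u in a..t, K * ((u - a) ^ m / m.factorial) := by
      refine intervalIntegral.norm_integral_le_of_norm_le ht ?_ ?_
      · exact Eventually.of_forall fun u hu => ih (k + 1) u hu.1.le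
      · exact Continuous.intervalIntegrable (by fun_prop) _ _
    refine h1.trans (le_of_eq ?_)
    rw [intervalIntegral.integral_const_mul, intervalIntegral.integral_div,
      intervalIntegral.integral_comp_sub_right (fun u => u ^ m) a, integral_pow]
    have e : k + 1 + m = k + (m + 1) := by ring
    simp only [K, e, sub_self]
    rw [Nat.factorial_succ]
    have : (m.factorial : ℝ) ≠ 0 := by positivity
    have : ((m : ℝ) + 1) ≠ 0 := by positivity
    push_cast
    field_simp
    simp

/-- The `m`-fold iterated bound tends to zero on an interval of length `1 / (4R)`: since `(k + m)! ≤
2 ^ (k + m) * k! * m!`, it is at most a constant times `(R * 2 * (1 / (4R))) ^ m = (1 / 2) ^ m`. -/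
theorem eq_zero_of_iterated_integral_of_le {ψ : ℕ → ℝ → ℝ} {C R a : ℝ} (hR : 0 < R)
    (hint : ∀ k t, a ≤ t → ψ k t = ψ k a + ∫ u in a..t, ψ (k + 1) u)
    (hb : ∀ k t, a ≤ t → |ψ k t| ≤ C * R ^ k * k.factorial) (h0 : ∀ k, ψ k a = 0)
    (k : ℕ) (t : ℝ) (hat : a ≤ t) (ht : t ≤ a + 1 / (4 * R)) : ψ k t = 0 := by
  have hC : 0 ≤ C := by
    have := (abs_nonneg _).trans (hb 0 a le_rfl)
    simpa using this
  have key : ∀ m : ℕ, |ψ k t| ≤ C * R ^ k * 2 ^ k * k.factorial * (1 / 2) ^ m := by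
    intro m
    refine (abs_le_of_iterated_integral hint hb h0 m k t hat).trans ?_
    have h1 : ((k + m).factorial : ℝ) ≤ 2 ^ (k + m) * k.factorial * m.factorial := by
      have h2 := Nat.add_choose_mul_factorial_mul_factorial k m
      have h4 : (k + m).factorial ≤ 2 ^ (k + m) * k.factorial * m.factorial := by
        rw [← h2]; gcongr; exact Nat.choose_le_two_pow _ _
      exact_mod_cast h4
    have h5 : (t - a) ^ m ≤ (1 / (4 * R)) ^ m := by
      apply pow_le_pow_left₀ <;> linarith
    have hm : (0 : ℝ) < m.factorial := by positivity
    calc C * R ^ (k + m) * (k + m).factorial * ((t - a) ^ m / m.factorial)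
        ≤ C * R ^ (k + m) * (2 ^ (k + m) * k.factorial * m.factorial)
            * ((1 / (4 * R)) ^ m / m.factorial) := by
          have : 0 ≤ (t - a) ^ m := pow_nonneg (by linarith) _
          gcongr
      _ = C * R ^ k * 2 ^ k * k.factorial * (R * 2 * (1 / (4 * R))) ^ m := by
          rw [mul_pow, mul_pow, pow_add, pow_add]; field_simp
      _ = _ := by congr 2; field_simp; norm_num
  have hlim : Tendsto (fun m : ℕ => C * R ^ k * 2 ^ k * k.factorial * (1 / 2 : ℝ) ^ m) atTop
      (𝓝 (C * R ^ k * 2 ^ k * k.factorial * 0)) :=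
    (tendsto_pow_atTop_nhds_zero_of_lt_one (by norm_num) (by norm_num)).const_mul _
  have := ge_of_tendsto' hlim key
  simpa using this

/-- A function whose iterated derivatives vanish at the origin and grow at most like `R ^ k * k!`
vanishes. -/
theorem eq_zero_of_iterated_integral {ψ : ℕ → ℝ → ℝ} {C R : ℝ} (hR : 0 < R)
    (hint : ∀ k s t, 0 ≤ s → s ≤ t → ψ k t = ψ k s + ∫ u in s..t, ψ (k + 1) u)
    (hb : ∀ k t, 0 ≤ t → |ψ k t| ≤ C * R ^ k * k.factorial) (h0 : ∀ k, ψ k 0 = 0)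
    (k : ℕ) (t : ℝ) (ht : 0 ≤ t) : ψ k t = 0 := by
  -- The bound `hb` is uniform in time, so the same step length `1 / (4R)` works from every new base
  -- point.
  have key : ∀ n : ℕ, ∀ k t, 0 ≤ t → t ≤ n * (1 / (4 * R)) → ψ k t = 0 := by
    intro n
    induction n with
    | zero =>
      intro k t h1 h2
      have : t = 0 := by simp at h2; linarith
      rw [this, h0]
    | succ n ih =>
      intro k t h1 h2
      have hr : 0 < 1 / (4 * R) := by positivity
      have hn : 0 ≤ (n : ℝ) * (1 / (4 * R)) := by positivity
      rcases le_total t (n * (1 / (4 * R))) with h | h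
      · exact ih k t h1 h
      · refine eq_zero_of_iterated_integral_of_le (C := C) hR
          (fun k t h => hint k _ t hn h) (fun k t h => hb k t (hn.trans h))
          (fun k => ih k _ hn le_rfl) k t h ?_
        push_cast at h2
        linarith
  obtain ⟨n, hn⟩ := exists_nat_ge (t / (1 / (4 * R)))
  refine key n k t ht ?_
  rwa [div_le_iff₀ (by positivity)] at hn

/-! ### A solution of the matrix product ansatz -/

instance isOrderedModule_nat_fun : IsOrderedModule ℝ (ℕ → ℝ) where
  smul_le_smul_of_nonneg_left _ ha _ _ h i := mul_le_mul_of_nonneg_left (h i) ha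
  smul_le_smul_of_nonneg_right _ hu _ _ h i := mul_le_mul_of_nonneg_right h (hu i)

/-- The bidiagonal solution of the matrix product ansatz. -/
def bidiagonalAnsatz (α : ℝ) (hα : 0 < α) : MatrixAnsatz α (ℕ → ℝ) where
  D :=
    { toFun := fun u k => (u k + u (k + 1)) / 4
      map_add' := fun u u' => by ext k; simp; ring
      map_smul' := fun r u => by ext k; simp; ring }
  E :=
    { toFun := fun u k => k.casesOn (u 0 / (4 * α)) fun j => (u j + u (j + 1)) / 4
      map_add' := fun u u' => by ext (_ | k) <;> simp <;> ring
      map_smul' := fun r u => by ext (_ | k) <;> simp <;> ring }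
  w := LinearMap.proj 0
  -- Affine sequences are fixed by `D + E` in all rows `k ≥ 1`; row `0` forces the slope `2 - 1 /
  -- α`.
  v := fun k => 1 + k * (2 - 1 / α)
  D_nonneg := fun u hu k => by
    have := hu k; have := hu (k + 1)
    simp at *
    positivity
  E_nonneg := fun u hu k => by
    cases k with
    | zero => have := hu 0; simp at *; positivity
    | succ k => have := hu k; have := hu (k + 1); simp at *; positivity
  D_mul_E := by
    apply LinearMap.ext
    intro u
    funext k
    cases k with
    | zero => simp; ring
    | succ k => simp; ring
  w_E := fun u => by simp; field_simp
  D_add_E := by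
    funext k
    cases k with
    | zero => simp; field_simp; ring
    | succ k => simp; field_simp; ring
  w_v := by simp

theorem bidiagonalAnsatz_D_apply (α : ℝ) (hα : 0 < α) (u : ℕ → ℝ) (k : ℕ) :
    (bidiagonalAnsatz α hα).D u k = (u k + u (k + 1)) / 4 := rfl

/-- On an affine sequence `D` halves the values and shifts the argument by `1 / 2`, which adds half
of the slope `2 - 1 / α`, that is `(α - 1 / 2) / α`. The induction runs over all coordinates because
`D` reads the next one. -/
theorem bidiagonalAnsatz_w_D_pow_v (α : ℝ) (hα : 0 < α) (k : ℕ) :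
    (bidiagonalAnsatz α hα).w (((bidiagonalAnsatz α hα).D ^ k) (bidiagonalAnsatz α hα).v) =
      1 / 2 ^ k * (1 + (α - 1 / 2) / α * k) := by
  have key : ∀ k j : ℕ, ((bidiagonalAnsatz α hα).D ^ k) (bidiagonalAnsatz α hα).v j =
      1 / 2 ^ k * (1 + (α - 1 / 2) / α * k + j * (2 - 1 / α)) := by
    intro k
    induction k with
    | zero => intro j; simp [bidiagonalAnsatz]
    | succ k ih =>
      intro j
      rw [pow_succ', Module.End.mul_apply]
      rw [bidiagonalAnsatz_D_apply, ih, ih]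
      push_cast
      rw [pow_succ]
      field_simp
      ring
  refine (key k 0).trans ?_
  simp

/-! ### The action of the 0-Hecke monoid of type B on configurations -/

section Hecke

variable {C C' : Type*} [LinearOrder C] [LinearOrder C']

/-- The generators of the 0-Hecke monoid: the letter `0` puts the color `b` at the first site, the
letter `x + 1` moves the larger color across the bond `x, x + 1` to the left. -/
def hecke (b : C) : ℕ → (ℕ → C) → ℕ → C
  | 0, η => Function.update η 0 b
  | x + 1, η => if η x < η (x + 1) then fun y => η (Equiv.swap x (x + 1) y) else η

/-- The action of a word, the first letter acting first. -/
def act (b : C) (u : List ℕ) (η : ℕ → C) : ℕ → C := u.foldl (fun η i => hecke b i η) η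

@[simp] theorem act_nil (b : C) (η : ℕ → C) : act b [] η = η := rfl

@[simp] theorem act_cons (b : C) (i : ℕ) (u : List ℕ) (η : ℕ → C) :
    act b (i :: u) η = act b u (hecke b i η) := rfl

@[simp] theorem act_append (b : C) (u u' : List ℕ) (η : ℕ → C) :
    act b (u ++ u') η = act b u' (act b u η) := by simp [act]

/-- Merging colors monotonically is compatible with the dynamics: if the two colors at a bond are
merged, their exchange is no longer visible. -/
theorem hecke_map {φ : C → C'} (hφ : Monotone φ) (b : C) (i : ℕ) (η : ℕ → C) :
    hecke (φ b) i (φ ∘ η) = φ ∘ hecke b i η := by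
  cases i with
  | zero => simp only [hecke]; rw [Function.comp_update]
  | succ x =>
    simp only [hecke, Function.comp_apply]
    split_ifs with h1 h2 h2
    · rfl
    · exact absurd (hφ (not_lt.1 h2)) (not_le.2 h1)
    · have h3 : φ (η x) = φ (η (x + 1)) := le_antisymm (hφ h2.le) (not_lt.1 h1)
      funext y
      rcases eq_or_ne y x with rfl | hx
      · simp [h3]
      rcases eq_or_ne y (x + 1) with rfl | hx'
      · simp [h3]
      · simp [Equiv.swap_apply_of_ne_of_ne hx hx']
    · rfl

theorem act_map {φ : C → C'} (hφ : Monotone φ) (b : C) (u : List ℕ) (η : ℕ → C) :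
    act (φ b) u (φ ∘ η) = φ ∘ act b u η := by
  induction u generalizing η with
  | nil => rfl
  | cons i u ih => rw [act_cons, hecke_map hφ, ih, act_cons]

/-! ### Color-position symmetry -/

/-- Every nonzero color occurs at most once. -/
def InjectiveColors (π : ℕ → ℕ) : Prop := ∀ p q, π p = π q → π p ≠ 0 → p = q

theorem InjectiveColors.hecke {π : ℕ → ℕ} (h : InjectiveColors π) (i : ℕ) :
    InjectiveColors (hecke 0 i π) := by
  intro p q
  cases i with
  | zero =>
    simp only [HalfLineTASEP.hecke, Function.update_apply]
    split_ifs with h1 h2 h2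
    · simp
    · simp
    · intro h3 h4; exact absurd h3 h4
    · exact h p q
  | succ x =>
    simp only [HalfLineTASEP.hecke]
    split_ifs with h1
    · intro h2 h3
      exact (Equiv.swap x (x + 1)).injective (h _ _ h2 h3)
    · exact h p q

theorem InjectiveColors.act {π : ℕ → ℕ} (h : InjectiveColors π) (u : List ℕ) :
    InjectiveColors (act 0 u π) := by
  induction u generalizing π with
  | nil => exact h
  | cons i u ih => exact ih (h.hecke i)

/-- `π` and `π'` evolved by the same word from initial conditions that differ by exchanging the
neighboring colors `c < c + 1`, which were ordered in `π`. Either they are still ordered in `π`,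
or they have been exchanged and `π = π'`. -/
def Linked (c : ℕ) (π π' : ℕ → ℕ) : Prop :=
  (π' = Equiv.swap c (c + 1) ∘ π ∧ (∀ p q, π p = c + 1 → π q = c → q < p) ∧
    ((∃ q, π q = c) → ∃ p, π p = c + 1)) ∨
  (π' = π ∧ (∀ p q, π p = c + 1 → π q = c → p < q) ∧
    ((∃ p, π p = c + 1) → ∃ q, π q = c))

theorem swap_lt_swap_iff {c a b : ℕ} (h1 : ¬(a = c ∧ b = c + 1)) (h2 : ¬(a = c + 1 ∧ b = c)) :
    Equiv.swap c (c + 1) a < Equiv.swap c (c + 1) b ↔ a < b := by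
  simp only [Equiv.swap_apply_def]
  split_ifs <;> omega

theorem swap_lt_of_lt {y p q : ℕ} (h : Equiv.swap y (y + 1) p < Equiv.swap y (y + 1) q)
    (h' : ¬(Equiv.swap y (y + 1) p = y ∧ Equiv.swap y (y + 1) q = y + 1)) : p < q := by
  simp only [Equiv.swap_apply_def] at h h'
  split_ifs at h h' <;> omega

/-- Neighboring colors compare in the same way with every other color, including `0` because `c >
0`. So a letter treats both configurations alike unless it meets `c` and `c + 1` side by side; then
it merges them. The survival clauses persist because the reservoir can only destroy the left one of
the two colors first. -/
theorem Linked.hecke {c : ℕ} (hc : 0 < c) {π π' : ℕ → ℕ} (hπ : InjectiveColors π)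
    (h : Linked c π π') (i : ℕ) : Linked c (hecke 0 i π) (hecke 0 i π') := by
  have hex : ∀ y d, (∃ p, π p = d) → ∃ p, π (Equiv.swap y (y + 1) p) = d := by
    rintro y d ⟨p, hp⟩
    exact ⟨Equiv.swap y (y + 1) p, by simpa using hp⟩
  have hex' : ∀ y d, (∃ p, π (Equiv.swap y (y + 1) p) = d) → ∃ p, π p = d := by
    rintro y d ⟨p, hp⟩
    exact ⟨_, hp⟩
  rcases h with ⟨rfl, hord, hal⟩ | ⟨rfl, hord, hal⟩
  · cases i with
    | zero =>
      left
      simp only [HalfLineTASEP.hecke]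
      refine ⟨?_, ?_, ?_⟩
      · rw [Function.comp_update, Equiv.swap_apply_of_ne_of_ne (by omega) (by omega)]
      · intro p q hp hq
        simp only [Function.update_apply] at hp hq
        split_ifs at hp hq
        any_goals omega
        exact hord p q hp hq
      · rintro ⟨q, hq⟩
        simp only [Function.update_apply] at hq
        split_ifs at hq with h0
        · omega
        · obtain ⟨p, hp⟩ := hal ⟨q, hq⟩
          have := hord p q hp hq
          exact ⟨p, by rw [Function.update_of_ne (by omega)]; exact hp⟩
    | succ y =>
      simp only [HalfLineTASEP.hecke, Function.comp_apply]
      -- The only comparison on which the two configurations disagree: the letter exchanges the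
      -- colors in `π` and is idle in `π'`, after which both coincide.
      by_cases h1 : π y = c ∧ π (y + 1) = c + 1
      · right
        rw [h1.1, h1.2, if_neg (by simp), if_pos (by omega)]
        refine ⟨?_, ?_, fun _ => ⟨y + 1, by simp [h1.1]⟩⟩
        · funext z
          rcases eq_or_ne z y with rfl | hz
          · simp [h1.1, h1.2]
          rcases eq_or_ne z (y + 1) with rfl | hz'
          · simp [h1.1, h1.2]
          rw [Equiv.swap_apply_of_ne_of_ne hz hz', Function.comp_apply,
            Equiv.swap_apply_of_ne_of_ne]
          · intro h; exact hz (hπ z y (h.trans h1.1.symm) (by omega))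
          · intro h; exact hz' (hπ z (y + 1) (h.trans h1.2.symm) (by omega))
        · intro p q hp hq
          have hp' := hπ _ (y + 1) (hp.trans h1.2.symm) (by omega)
          have hq' := hπ _ y (hq.trans h1.1.symm) (by omega)
          rw [Equiv.swap_apply_eq_iff] at hp' hq'
          simp at hp' hq'
          omega
      · left
        have h2 : ¬(π y = c + 1 ∧ π (y + 1) = c) := by
          rintro ⟨h2, h3⟩
          have := hord _ _ h2 h3
          omega
        simp only [swap_lt_swap_iff h1 h2]
        split_ifs with h3
        · refine ⟨rfl, ?_, fun h => hex y _ (hal (hex' y _ h))⟩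
          intro p q hp hq
          refine swap_lt_of_lt (hord _ _ hp hq) ?_
          rintro ⟨h4, h5⟩
          beta_reduce at hp hq
          rw [h4] at hq
          rw [h5] at hp
          exact h1 ⟨hq, hp⟩
        · exact ⟨rfl, hord, hal⟩
  · right
    refine ⟨rfl, ?_⟩
    cases i with
    | zero =>
      simp only [HalfLineTASEP.hecke]
      constructor
      · intro p q hp hq
        simp only [Function.update_apply] at hp hq
        split_ifs at hp hq
        any_goals omega
        exact hord p q hp hq
      · rintro ⟨p, hp⟩
        simp only [Function.update_apply] at hp
        split_ifs at hp with h0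
        obtain ⟨q, hq⟩ := hal ⟨p, hp⟩
        have := hord p q hp hq
        exact ⟨q, by rw [Function.update_of_ne (by omega)]; exact hq⟩
    | succ y =>
      simp only [HalfLineTASEP.hecke]
      split_ifs with h3
      · refine ⟨?_, fun h => hex y _ (hal (hex' y _ h))⟩
        intro p q hp hq
        refine swap_lt_of_lt (hord _ _ hp hq) ?_
        rintro ⟨h4, h5⟩
        beta_reduce at hp hq
        rw [h4] at hp
        rw [h5] at hq
        omega
      · exact ⟨hord, hal⟩

theorem Linked.act {c : ℕ} (hc : 0 < c) {π π' : ℕ → ℕ} (hπ : InjectiveColors π)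
    (h : Linked c π π') (u : List ℕ) : Linked c (act 0 u π) (act 0 u π') := by
  induction u generalizing π π' with
  | nil => exact h
  | cons i u ih => exact ih (hπ.hecke i) (h.hecke hc hπ i)

theorem injectiveColors_succ : InjectiveColors Nat.succ := fun _ _ h _ => Nat.succ_injective h

theorem linked_succ (x : ℕ) : Linked (x + 1) Nat.succ (hecke 0 (x + 1) Nat.succ) := by
  left
  refine ⟨?_, ?_, fun _ => ⟨x + 1, rfl⟩⟩
  · simp only [hecke, if_pos (Nat.lt_succ_self (Nat.succ x))]
    funext y
    simp only [Function.comp_apply, Equiv.swap_apply_def, Nat.succ_eq_add_one]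
    split_ifs <;> omega
  · intro p q hp hq
    simp only [Nat.succ_eq_add_one] at hp hq
    omega

/-- An initial letter `0` overwrites color `1`, which amounts to merging color `1` into the
reservoir color by the monotone map `κ`; merging commutes with the rest of the word. -/
theorem exists_act_cons_zero (u : List ℕ) (j : ℕ) :
    (∃ p, act 0 (0 :: u) Nat.succ p = j + 1) ↔ j ≠ 0 ∧ ∃ p, act 0 u Nat.succ p = j + 1 := by
  set κ : ℕ → ℕ := fun c => if c = 1 then 0 else c
  have hκ : Monotone κ := by
    intro a b hab
    simp only [κ]
    split_ifs <;> omega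
  have h1 : hecke 0 0 Nat.succ = κ ∘ Nat.succ := by
    funext y
    cases y <;> simp [hecke, κ]
  have h2 := act_map hκ 0 u Nat.succ
  rw [act_cons, h1]
  have h0 : κ 0 = 0 := by simp [κ]
  rw [h0] at h2
  rw [h2]
  simp only [Function.comp_apply, κ]
  constructor
  · rintro ⟨p, hp⟩
    split_ifs at hp with h
    exact ⟨by omega, p, hp⟩
  · rintro ⟨hj, p, hp⟩
    exact ⟨p, by rw [hp, if_neg (by omega)]⟩

-- Induction on the word: a letter prepended to `u` acts last in `u.reverse`. On the colored side it
-- acts first, on the identity coloring, and `Linked` compares the continuations with and without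
-- it.
open Classical in
theorem act_reverse_stepInit (u : List ℕ) (j : ℕ) :
    act Color.first u.reverse stepInit j =
      if ∃ p, act 0 u Nat.succ p = j + 1 then Color.hole else Color.first := by
  induction u generalizing j with
  | nil => rw [if_pos ⟨j, rfl⟩]; rfl
  | cons i u ih =>
    rw [List.reverse_cons, act_append, act_cons, act_nil]
    cases i with
    | zero =>
      rw [exists_act_cons_zero]
      simp only [hecke, Function.update_apply, ih]
      by_cases hj : j = 0 <;> simp [hj]
    | succ x =>
      have hfh : Color.first < Color.hole := by decide
      have hl := (linked_succ x).act (Nat.succ_pos x) injectiveColors_succ u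
      rw [act_cons]
      set π := act 0 u Nat.succ
      set π' := act 0 u (hecke 0 (x + 1) Nat.succ)
      simp only [hecke, ih]
      -- If the runs are still linked, the sets of surviving colors differ by exchanging `x + 1` and
      -- `x + 2`, and `h3` says that a hole at site `x` implies one at `x + 1`; so the last letter
      -- performs just this exchange.
      rcases hl with ⟨h1, -, h3⟩ | ⟨h1, -, h3⟩
      · rw [h1]
        have e1 : ∀ d, (∃ p, (Equiv.swap (x + 1) (x + 1 + 1) ∘ π) p = d) ↔
            ∃ p, π p = Equiv.swap (x + 1) (x + 1 + 1) d := by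
          intro d
          simp only [Function.comp_apply, Equiv.swap_apply_eq_iff]
        rw [e1]
        have e2 : Equiv.swap (x + 1) (x + 1 + 1) (j + 1) = Equiv.swap x (x + 1) j + 1 := by
          simp only [Equiv.swap_apply_def]
          split_ifs <;> omega
        rw [e2]
        by_cases hx : ∃ p, π p = x + 1
        · have hx' := h3 hx
          rw [if_pos hx, if_pos hx', if_neg (lt_irrefl _)]
          rcases eq_or_ne j x with rfl | hjx
          · simp [hx, hx', ih]
          rcases eq_or_ne j (x + 1) with rfl | hjx'
          · simp [hx, hx', ih]
          rw [Equiv.swap_apply_of_ne_of_ne hjx hjx', ih]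
        · rw [if_neg hx]
          by_cases hx' : ∃ p, π p = x + 1 + 1
          · rw [if_pos hx', if_pos hfh]
          · rw [if_neg hx', if_neg (lt_irrefl _)]
            rcases eq_or_ne j x with rfl | hjx
            · simp [hx, hx', ih]
            rcases eq_or_ne j (x + 1) with rfl | hjx'
            · simp [hx, hx', ih]
            rw [Equiv.swap_apply_of_ne_of_ne hjx hjx', ih]
      -- If the runs have merged, survival of `x + 2` implies survival of `x + 1`, so a hole never
      -- stands directly to the right of a particle at this bond and the last letter is idle.
      · rw [h1, if_neg, ih]
        by_cases hx' : ∃ p, π p = x + 1 + 1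
        · rw [if_pos (h3 hx'), if_pos hx']
          exact lt_irrefl _
        · rw [if_neg hx']
          split_ifs
          · exact hfh.not_gt
          · exact lt_irrefl _

/-- Color-position symmetry: the number of particles of color `c` is the number of sites in `J`
that are still empty when the word acts in the reverse order on the empty configuration, where
`J` is the set of particles which initially have the color `c`. -/
theorem encard_act_eq_card_reverse {φ : ℕ → Color} (hφ : Monotone φ) (h0 : φ 0 = Color.first)
    {c : Color} {J : Finset ℕ} (hJ : ∀ d, φ d = c ↔ ∃ j ∈ J, d = j + 1) (u : List ℕ) :
    {p | act Color.first u (φ ∘ Nat.succ) p = c}.encard =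
      ((J.filter fun j => act Color.first u.reverse stepInit j = Color.hole).card : ℕ∞) := by
  have hinj := injectiveColors_succ.act u
  rw [← h0, act_map hφ, h0, ← Set.encard_coe_eq_coe_finsetCard]
  simp only [act_reverse_stepInit, Function.comp_apply]
  set π := act 0 u Nat.succ
  have h1 : Set.InjOn π {p | φ (π p) = c} := by
    intro p hp q _ hpq
    refine hinj p q hpq ?_
    obtain ⟨j, -, hj⟩ := (hJ _).1 hp
    rw [hj]; exact Nat.succ_ne_zero j
  rw [← h1.encard_image,
    ← Nat.succ_injective.encard_image (Finset.filter _ J : Set ℕ)]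
  congr 1
  ext d
  simp only [Set.mem_image, Set.mem_ofPred_eq, Finset.coe_filter]
  constructor
  · rintro ⟨p, hp, rfl⟩
    obtain ⟨j, hj, hj'⟩ := (hJ _).1 hp
    exact ⟨j, ⟨hj, by rw [if_pos ⟨p, hj'⟩]⟩, hj'.symm⟩
  · rintro ⟨j, ⟨hj, hj'⟩, rfl⟩
    split_ifs at hj' with h
    obtain ⟨p, hp⟩ := h
    exact ⟨p, (hJ _).2 ⟨j, hj, hp⟩, hp⟩

end Hecke

/-! ### Sorting words -/

section Sorting

variable {C : Type*} [LinearOrder C]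

/-- Letters strictly between `m` and `n` only rearrange the contents of `[m, n)`, so color counts
there are conserved. -/
theorem act_eq_comp_perm (b : C) {m n : ℕ} (u : List ℕ) (hu : ∀ i ∈ u, m < i ∧ i < n)
    (η : ℕ → C) : ∃ e : Equiv.Perm ℕ, (∀ j, ¬(m ≤ j ∧ j < n) → e j = j) ∧ act b u η = η ∘ e := by
  induction u generalizing η with
  | nil => exact ⟨1, fun _ _ => rfl, rfl⟩
  | cons i u ih =>
    obtain ⟨hi, hu⟩ := List.forall_mem_cons.1 hu
    obtain ⟨e, he, he'⟩ := ih hu (hecke b i η)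
    rw [act_cons, he']
    cases i with
    | zero => omega
    | succ x =>
      simp only [hecke]
      split_ifs with h
      · refine ⟨e.trans (Equiv.swap x (x + 1)), fun j hj => ?_, rfl⟩
        rw [Equiv.trans_apply, he j hj, Equiv.swap_apply_of_ne_of_ne] <;> omega
      · exact ⟨e, he, rfl⟩

theorem perm_mem_iff {m n : ℕ} {e : Equiv.Perm ℕ} (he : ∀ j, ¬(m ≤ j ∧ j < n) → e j = j)
    (j : ℕ) : (m ≤ e j ∧ e j < n) ↔ (m ≤ j ∧ j < n) := by
  by_cases h : m ≤ j ∧ j < n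
  · refine ⟨fun _ => h, fun _ => ?_⟩
    by_contra h'
    have := he _ h'
    rw [e.injective this] at h'
    exact h' h
  · rw [he j h]

theorem card_filter_comp_perm {m n : ℕ} {e : Equiv.Perm ℕ}
    (he : ∀ j, ¬(m ≤ j ∧ j < n) → e j = j) (p : ℕ → Prop) [DecidablePred p] :
    ((Finset.Ico m n).filter fun j => p (e j)).card = ((Finset.Ico m n).filter p).card := by
  refine Finset.card_equiv e fun j => ?_
  simp only [Finset.mem_filter, Finset.mem_Ico, perm_mem_iff he]

/-- `η` is weakly decreasing on `[m, n)`. -/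
def SortedOn (η : ℕ → C) (m n : ℕ) : Prop := ∀ i j, m ≤ i → i ≤ j → j < n → η j ≤ η i

theorem act_eq_self_of_sortedOn (b : C) {m n : ℕ} (u : List ℕ) (hu : ∀ i ∈ u, m < i ∧ i < n)
    {η : ℕ → C} (h : SortedOn η m n) : act b u η = η := by
  induction u with
  | nil => rfl
  | cons i u ih =>
    obtain ⟨hi, hu'⟩ := List.forall_mem_cons.1 hu
    cases i with
    | zero => omega
    | succ x =>
      rw [act_cons, hecke, if_neg (not_lt.2 (h x (x + 1) (by omega) (by omega) (by omega))), ih hu']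

/-- The word that moves the content of site `a + n` into its place in the sorted interval
`[a, a + n)`. -/
def insertWord (a : ℕ) : ℕ → List ℕ
  | 0 => []
  | n + 1 => (a + n + 1) :: insertWord a n

/-- Insertion sort on the interval `[a, a + n)`. -/
def insertionSortWord (a : ℕ) : ℕ → List ℕ
  | 0 => []
  | n + 1 => insertionSortWord a n ++ insertWord a n

/-- A palindromic word that sorts the interval `[a, a + n)`. -/
def sortWord (a n : ℕ) : List ℕ := insertionSortWord a n ++ (insertionSortWord a n).reverse

theorem mem_insertWord {a n i : ℕ} (h : i ∈ insertWord a n) : a < i ∧ i < a + n + 1 := by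
  induction n with
  | zero => simp [insertWord] at h
  | succ n ih =>
    rcases List.mem_cons.1 h with rfl | h
    · omega
    · have := ih h
      omega

theorem mem_insertionSortWord {a n i : ℕ} (h : i ∈ insertionSortWord a n) :
    a < i ∧ i < a + n := by
  induction n with
  | zero => simp [insertionSortWord] at h
  | succ n ih =>
    rcases List.mem_append.1 h with h | h
    · have := ih h
      omega
    · exact mem_insertWord h

theorem mem_sortWord {a n i : ℕ} (h : i ∈ sortWord a n) : a < i ∧ i < a + n := by
  rcases List.mem_append.1 h with h | h
  · exact mem_insertionSortWord h
  · exact mem_insertionSortWord (List.mem_reverse.1 h)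

theorem reverse_sortWord (a n : ℕ) : (sortWord a n).reverse = sortWord a n := by
  simp [sortWord]

/-- The first letter leaves the smaller of the last two values at the end. As the rest was sorted,
this is the minimum of the interval; the remaining letters do not touch that site and insert the
other value recursively. -/
theorem sortedOn_act_insertWord (b : C) (a n : ℕ) {η : ℕ → C} (h : SortedOn η a (a + n)) :
    SortedOn (act b (insertWord a n) η) a (a + n + 1) := by
  induction n generalizing η with
  | zero =>
    intro i j hi hij hj
    have : i = j := by omega
    rw [this]
  | succ n ih =>
    rw [insertWord, act_cons]
    set η₁ := hecke b (a + n + 1) η with hη₁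
    have h1 : SortedOn η₁ a (a + n) ∧ ∀ i, a ≤ i → i < a + n + 1 → η₁ (a + n + 1) ≤ η₁ i := by
      rw [hη₁, hecke]
      split_ifs with h2
      · constructor
        · intro i j hi hij hj
          beta_reduce
          rw [Equiv.swap_apply_of_ne_of_ne (by omega) (by omega),
            Equiv.swap_apply_of_ne_of_ne (by omega) (by omega)]
          exact h i j hi hij (by omega)
        · intro i hi hi'
          beta_reduce
          rw [Equiv.swap_apply_right]
          rcases eq_or_ne i (a + n) with rfl | hne
          · rw [Equiv.swap_apply_left]; exact h2.le
          · rw [Equiv.swap_apply_of_ne_of_ne (by omega) (by omega)]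
            exact h i _ hi (by omega) (by omega)
      · refine ⟨fun i j hi hij hj => h i j hi hij (by omega), fun i hi hi' => ?_⟩
        exact (not_lt.1 h2).trans (h i (a + n) hi (by omega) (by omega))
    obtain ⟨h1, h2⟩ := h1
    have h3 := ih h1
    obtain ⟨e, he, he'⟩ := act_eq_comp_perm b (insertWord a n) (fun i hi => mem_insertWord hi) η₁
    intro i j hi hij hj
    rcases eq_or_ne j (a + n + 1) with rfl | hne
    · rcases eq_or_ne i (a + n + 1) with rfl | hne'
      · exact le_rfl
      rw [he', Function.comp_apply, Function.comp_apply, he (a + n + 1) (by omega)]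
      have := (perm_mem_iff he i).2 (by omega)
      exact h2 _ this.1 this.2
    · exact h3 i j hi hij (by omega)

theorem sortedOn_act_insertionSortWord (b : C) (a n : ℕ) (η : ℕ → C) :
    SortedOn (act b (insertionSortWord a n) η) a (a + n) := by
  induction n with
  | zero => intro i j hi hij hj; omega
  | succ n ih =>
    rw [insertionSortWord, act_append]
    exact sortedOn_act_insertWord b a n ih

/-- The first half already sorts. The second half, present only to make the word a palindrome, fixes
a sorted interval. -/
theorem sortedOn_act_sortWord (b : C) (a n : ℕ) (η : ℕ → C) :
    SortedOn (act b (sortWord a n) η) a (a + n) := by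
  have h := sortedOn_act_insertionSortWord b a n η
  rwa [sortWord, act_append, act_eq_self_of_sortedOn b (m := a) (n := a + n) _ _ h]
  exact fun i hi => mem_insertionSortWord (List.mem_reverse.1 hi)

/-- The upper level sets of a decreasing sequence are initial segments, hence determined by their
cardinalities. -/
theorem SortedOn.le_iff {η : ℕ → C} {m n : ℕ} (h : SortedOn η m n) (c : C) {i : ℕ} (hi : m ≤ i)
    (hi' : i < n) :
    c ≤ η i ↔ i < m + ((Finset.Ico m n).filter fun j => c ≤ η j).card := by
  constructor
  · intro hc
    have h1 : Finset.Ico m (i + 1) ⊆ (Finset.Ico m n).filter fun j => c ≤ η j := by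
      intro j hj
      rw [Finset.mem_Ico] at hj
      rw [Finset.mem_filter, Finset.mem_Ico]
      exact ⟨by omega, hc.trans (h j i hj.1 (by omega) hi')⟩
    have h2 := Finset.card_le_card h1
    rw [Nat.card_Ico] at h2
    omega
  · intro hc
    by_contra hlt
    have h1 : ((Finset.Ico m n).filter fun j => c ≤ η j) ⊆ Finset.Ico m i := by
      intro j hj
      rw [Finset.mem_filter, Finset.mem_Ico] at hj
      rw [Finset.mem_Ico]
      refine ⟨hj.1.1, ?_⟩
      by_contra hij
      exact hlt (hj.2.trans (h i j hi (by omega) hj.1.2))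
    have h2 := Finset.card_le_card h1
    rw [Nat.card_Ico] at h2
    omega

theorem act_sortWord_of_not_mem (b : C) (a n : ℕ) (η : ℕ → C) {i : ℕ}
    (hi : ¬(a ≤ i ∧ i < a + n)) : act b (sortWord a n) η i = η i := by
  obtain ⟨e, he, he'⟩ := act_eq_comp_perm b (sortWord a n) (fun i hi => mem_sortWord hi) η
  rw [he', Function.comp_apply, he i hi]

theorem le_act_sortWord_iff (b : C) (a n : ℕ) (η : ℕ → C) (c : C) {i : ℕ} (hi : a ≤ i)
    (hi' : i < a + n) :
    c ≤ act b (sortWord a n) η i ↔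
      i < a + ((Finset.Ico a (a + n)).filter fun j => c ≤ η j).card := by
  rw [(sortedOn_act_sortWord b a n η).le_iff c hi hi']
  obtain ⟨e, he, he'⟩ := act_eq_comp_perm b (sortWord a n) (fun i hi => mem_sortWord hi) η
  rw [he', ← card_filter_comp_perm he (fun j => c ≤ η j)]
  rfl

/-- The sorted rearrangement is unique, so the result of sorting is certified by exhibiting any
permutation that leads to a sorted configuration. -/
theorem act_sortWord_eq (b : C) (a n : ℕ) {η τ : ℕ → C} (e : Equiv.Perm ℕ)
    (he : ∀ j, ¬(a ≤ j ∧ j < a + n) → e j = j) (hτ : ∀ j, τ j = η (e j))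
    (h : SortedOn τ a (a + n)) : act b (sortWord a n) η = τ := by
  funext i
  by_cases hi : a ≤ i ∧ i < a + n
  · refine eq_of_forall_le_iff fun c => ?_
    rw [le_act_sortWord_iff b a n η c hi.1 hi.2, h.le_iff c hi.1 hi.2]
    simp only [hτ]
    rw [card_filter_comp_perm he (fun j => c ≤ η j)]
  · rw [act_sortWord_of_not_mem b a n η hi, hτ, he i hi]

end Sorting

/-! ### The two-shock initial conditions -/

/-- The reflection of the interval `[m, n)`. -/
def reflectPerm (m n : ℕ) : Equiv.Perm ℕ where
  toFun i := if m ≤ i ∧ i < n then m + n - 1 - i else i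
  invFun i := if m ≤ i ∧ i < n then m + n - 1 - i else i
  left_inv i := by beta_reduce; split_ifs <;> omega
  right_inv i := by beta_reduce; split_ifs <;> omega

/-- The permutation that exchanges the blocks `[m, m + k)` and `[m + k, m + k + l)`. -/
def blockPerm (m k l : ℕ) : Equiv.Perm ℕ where
  toFun i := if m ≤ i ∧ i < m + l then i + k else if m + l ≤ i ∧ i < m + k + l then i - l else i
  invFun i := if m ≤ i ∧ i < m + k then i + l else if m + k ≤ i ∧ i < m + k + l then i - k else i
  left_inv i := by beta_reduce; split_ifs <;> omega
  right_inv i := by beta_reduce; split_ifs <;> omega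

/-- The word that creates the two-shock initial conditions from ordered ones. -/
def shockWord (M N : ℕ) : List ℕ :=
  sortWord M (2 * N + 1) ++ (sortWord 0 (M + N) ++ sortWord (M + N) (M + N + 1))

theorem reverse_shockWord (M N : ℕ) : (shockWord M N).reverse =
    sortWord (M + N) (M + N + 1) ++ (sortWord 0 (M + N) ++ sortWord M (2 * N + 1)) := by
  simp [shockWord, reverse_sortWord]

/-- The class of the particle of color `d`: first class up to `k`, second class up to `m`, third
class up to `n`, and holes afterwards. -/
def classify (k m n d : ℕ) : Color :=
  if d ≤ k then Color.first else if d ≤ m then Color.second else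
    if d ≤ n then Color.third else Color.hole

theorem classify_monotone {k m n : ℕ} : Monotone (classify k m n) := by
  intro a b hab
  unfold classify
  split_ifs
  all_goals first
    | decide
    | omega

theorem act_shockWord_eq {M N : ℕ} {η η₁ η₂ η₃ : Config}
    (h1 : ∀ j, η₁ j = η (reflectPerm M (M + 2 * N + 1) j)) (s1 : SortedOn η₁ M (M + 2 * N + 1))
    (h2 : ∀ j, η₂ j = η₁ (reflectPerm 0 (M + N) j)) (s2 : SortedOn η₂ 0 (M + N))
    (h3 : ∀ j, η₃ j = η₂ (blockPerm (M + N) (N + 1) M j))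
    (s3 : SortedOn η₃ (M + N) (2 * M + 2 * N + 1)) :
    act Color.first (shockWord M N) η = η₃ := by
  rw [shockWord, act_append, act_append,
    act_sortWord_eq _ _ _ (reflectPerm M (M + 2 * N + 1)) _ h1 s1,
    act_sortWord_eq _ _ _ (reflectPerm 0 (M + N)) _ h2 (by rwa [zero_add]),
    act_sortWord_eq _ _ _ (blockPerm (M + N) (N + 1) M) _ h3
      (by convert s3 using 1; omega)]
  · intro j hj
    simp only [blockPerm, Equiv.coe_fn_mk]
    split_ifs <;> omega
  · intro j hj
    simp only [reflectPerm, Equiv.coe_fn_mk]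
    split_ifs <;> omega
  · intro j hj
    simp only [reflectPerm, Equiv.coe_fn_mk]
    split_ifs <;> omega

/-- The sort of `[M, M + 2N + 1)` reverses `N` first class particles, the second class particle and
`N` holes. The next sort reverses `M` particles and `N` holes, and the last one moves `M` holes in
front of the second class particle and the `N` particles behind it. -/
theorem act_shockWord_twoShockInit (M N : ℕ) :
    act Color.first (shockWord M N) (classify (M + N) (M + N + 1) (M + N + 1) ∘ Nat.succ) =
      twoShockInit M N := by
  apply act_shockWord_eq
    (η₁ := fun i => if i < M then Color.first else if i < M + N then Color.hole else
      if i = M + N then Color.second else if i < M + 2 * N + 1 then Color.first else Color.hole)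
    (η₂ := fun i => if i < N then Color.hole else if i < M + N then Color.first else
      if i = M + N then Color.second else if i < M + 2 * N + 1 then Color.first else Color.hole)
  · intro j
    simp only [reflectPerm, Equiv.coe_fn_mk, classify, Function.comp_apply, Nat.succ_eq_add_one]
    split_ifs <;> first | rfl | omega
  · intro i j hi hij hj
    beta_reduce
    split_ifs <;> first | decide | omega
  · intro j
    simp only [reflectPerm, Equiv.coe_fn_mk]
    split_ifs <;> first | rfl | omega
  · intro i j hi hij hj
    beta_reduce
    split_ifs <;> first | decide | omega
  · intro j
    simp only [blockPerm, Equiv.coe_fn_mk, twoShockInit]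
    split_ifs <;> first | rfl | omega
  · intro i j hi hij hj
    simp only [twoShockInit]
    split_ifs <;> first | decide | omega

/-- The same three rearrangements; with first argument `0` in `classify`, only the reservoir color
`0` is first class. -/
theorem act_shockWord_twoShockInit' (M N : ℕ) :
    act Color.first (shockWord M N) (classify 0 M (M + N + 1) ∘ Nat.succ) =
      twoShockInit' M N := by
  apply act_shockWord_eq
    (η₁ := fun i => if i < M then Color.second else if i < M + N then Color.hole else
      if i < M + 2 * N + 1 then Color.third else Color.hole)
    (η₂ := fun i => if i < N then Color.hole else if i < M + N then Color.second else
      if i < M + 2 * N + 1 then Color.third else Color.hole)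
  · intro j
    simp only [reflectPerm, Equiv.coe_fn_mk, classify, Function.comp_apply, Nat.succ_eq_add_one]
    split_ifs <;> first | rfl | omega
  · intro i j hi hij hj
    beta_reduce
    split_ifs <;> first | decide | omega
  · intro j
    simp only [reflectPerm, Equiv.coe_fn_mk]
    split_ifs <;> first | rfl | omega
  · intro i j hi hij hj
    beta_reduce
    split_ifs <;> first | decide | omega
  · intro j
    simp only [blockPerm, Equiv.coe_fn_mk, twoShockInit']
    split_ifs <;> first | rfl | omega
  · intro i j hi hij hj
    simp only [twoShockInit']
    split_ifs <;> first | decide | omega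

/-! ### The reversed word -/

/-- The number of holes of `ζ` in `[m, n)`. -/
def holes (ζ : Config) (m n : ℕ) : ℕ :=
  ((Finset.Ico m n).filter fun j => ζ j = Color.hole).card

theorem hole_le_iff (c : Color) : Color.hole ≤ c ↔ c = Color.hole := by
  cases c <;> decide

theorem act_sortWord_eq_hole_iff (a n : ℕ) (ζ : Config) {i : ℕ} (hi : a ≤ i) (hi' : i < a + n) :
    act Color.first (sortWord a n) ζ i = Color.hole ↔ i < a + holes ζ a (a + n) := by
  rw [← hole_le_iff, le_act_sortWord_iff _ _ _ _ _ hi hi', holes]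
  simp only [hole_le_iff]

/-- The number of holes that the reversed word produces in the window `[M, M + 2N + 1)`. -/
def windowHoles (M N : ℕ) (ζ : Config) : ℕ :=
  (holes ζ 0 (M + N) - M) + min (holes ζ (M + N) (2 * M + 2 * N + 1)) (N + 1)

/-- The two block sorts push the holes to the left ends of `[0, M + N)` and `[M + N, 2M + 2N + 1)`.
The window `[M, M + 2N + 1)` contains all but the first `M` holes of the left block and at most `N +
1` holes of the right one; the last sort collects them at its left end. -/
theorem act_reverse_shockWord_eq_hole_iff (M N : ℕ) (ζ : Config) {i : ℕ} (hi : M ≤ i)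
    (hi' : i < M + 2 * N + 1) :
    act Color.first (shockWord M N).reverse ζ i = Color.hole ↔ i < M + windowHoles M N ζ := by
  rw [reverse_shockWord, act_append, act_append]
  set ζ₁ := act Color.first (sortWord (M + N) (M + N + 1)) ζ with hζ₁
  set ζ₂ := act Color.first (sortWord 0 (M + N)) ζ₁ with hζ₂
  have h1 : ∀ i, M + N ≤ i → i < 2 * M + 2 * N + 1 →
      (ζ₂ i = Color.hole ↔ i < M + N + holes ζ (M + N) (2 * M + 2 * N + 1)) := by
    intro i hi hi'
    rw [hζ₂, act_sortWord_of_not_mem _ _ _ _ (by omega), hζ₁,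
      act_sortWord_eq_hole_iff _ _ _ hi (by omega)]
    rw [show M + N + (M + N + 1) = 2 * M + 2 * N + 1 by omega]
  have h2 : ∀ i, i < M + N → (ζ₂ i = Color.hole ↔ i < holes ζ 0 (M + N)) := by
    intro i hi
    rw [hζ₂, act_sortWord_eq_hole_iff _ _ _ (Nat.zero_le _) (by omega)]
    have : holes ζ₁ 0 (0 + (M + N)) = holes ζ 0 (M + N) := by
      rw [zero_add, holes, holes]
      congr 1
      refine Finset.filter_congr fun j hj => ?_
      rw [Finset.mem_Ico] at hj
      rw [hζ₁, act_sortWord_of_not_mem _ _ _ _ (by omega)]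
    rw [this, zero_add]
  have hz : holes ζ 0 (M + N) ≤ M + N := by
    have := Finset.card_filter_le (Finset.Ico 0 (M + N)) fun j => ζ j = Color.hole
    rwa [Nat.card_Ico] at this
  rw [act_sortWord_eq_hole_iff _ _ _ hi (by omega)]
  suffices h : holes ζ₂ M (M + (2 * N + 1)) = windowHoles M N ζ by rw [h]
  have h3 : ((Finset.Ico M (M + (2 * N + 1))).filter fun j => ζ₂ j = Color.hole) =
      Finset.Ico M (holes ζ 0 (M + N)) ∪
      Finset.Ico (M + N) (M + N + min (holes ζ (M + N) (2 * M + 2 * N + 1)) (N + 1)) := by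
    ext j
    simp only [Finset.mem_filter, Finset.mem_union, Finset.mem_Ico]
    by_cases hj : M ≤ j ∧ j < M + (2 * N + 1)
    · rcases lt_or_ge j (M + N) with hj' | hj'
      · rw [h2 j hj']
        omega
      · rw [h1 j hj' (by omega)]
        omega
    · omega
  rw [holes, h3, Finset.card_union_of_disjoint, windowHoles, Nat.card_Ico, Nat.card_Ico, Nat.add_sub_cancel_left]
  rw [Finset.disjoint_left]
  intro j hj hj'
  simp only [Finset.mem_Ico] at hj hj'
  omega

/-! ### The generator as a sum over the letters of the 0-Hecke monoid -/

/-- The rate of a letter. -/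
def rate (α : ℝ) : ℕ → ℝ
  | 0 => α
  | _ + 1 => 1

theorem rate_nonneg {α : ℝ} (hα : 0 < α) (i : ℕ) : 0 ≤ rate α i := by
  cases i
  · exact hα.le
  · exact zero_le_one

theorem sum_rate (α : ℝ) (n : ℕ) : ∑ i ∈ Finset.range (n + 1), rate α i = α + n := by
  rw [Finset.sum_range_succ']
  simp [rate, add_comm]

theorem hecke_first_succ (x : ℕ) (η : Config) :
    hecke Color.first (x + 1) η = if η x < η (x + 1) then exchange η x else η := rfl

/-- The conditions on the rates can be dropped: a forbidden jump corresponds to a letter that fixes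
`η` and so contributes zero. Letters beyond `n` do not change `f`. -/
theorem generator_eq_sum (α : ℝ) {f : Config → ℝ} {n : ℕ}
    (h : ∀ x, n ≤ x → ∀ η, f (exchange η x) = f η) (η : Config) :
    generator α f η =
      ∑ i ∈ Finset.range (n + 1), rate α i * (f (hecke Color.first i η) - f η) := by
  rw [Finset.sum_range_succ', add_comm, generator]
  congr 1
  · change _ = α * (f (create η) - f η)
    split_ifs with h0
    · rfl
    · have : create η = η := by
        have h1 : η 0 = Color.first := le_antisymm (not_lt.1 h0) (by cases η 0 <;> decide)
        rw [create, ← h1, Function.update_eq_self]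
      rw [this, sub_self, mul_zero]
  · rw [tsum_eq_sum (s := Finset.range n)]
    · refine Finset.sum_congr rfl fun x _ => ?_
      rw [hecke_first_succ]
      split_ifs
      · exact (one_mul _).symm
      · rw [sub_self, mul_zero]
    · intro x hx
      rw [Finset.mem_range, not_lt] at hx
      rw [h x hx, sub_self, ite_self]

/-! ### Admissible functions -/

/-- Keep the first `m` sites and put holes everywhere else. -/
def trunc (m : ℕ) (η : Config) : Config := fun i => if i < m then η i else Color.hole

/-- Functions that are local up to the dependence on the number of particles of class `c`. -/
structure Admissible (c : Color) (n : ℕ) (K : ℝ) (f : Config → ℝ) : Prop where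
  bounded : ∀ η, |f η| ≤ K
  exchange_eq : ∀ x, n ≤ x → ∀ η, f (exchange η x) = f η
  tendsto : ∀ η, Tendsto (fun m => f (trunc m η)) atTop (𝓝 (f η))
  trunc_exchange : ∀ m η, n ≤ m → η m ≠ c → η (m + 1) ≠ c →
    f (trunc (m + 1) (exchange η m)) = f (trunc (m + 1) η)

theorem hecke_exchange {i x : ℕ} (h : i < x) (η : Config) :
    hecke Color.first i (exchange η x) = exchange (hecke Color.first i η) x := by
  cases i with
  | zero =>
    funext y
    simp only [hecke, exchange, Function.update_apply]
    have : Equiv.swap x (x + 1) y = 0 ↔ y = 0 := by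
      rw [Equiv.swap_apply_eq_iff, Equiv.swap_apply_of_ne_of_ne (by omega) (by omega)]
    simp only [this]
  | succ z =>
    have h1 : exchange η x z = η z := by
      rw [exchange, Equiv.swap_apply_of_ne_of_ne] <;> omega
    have h2 : exchange η x (z + 1) = η (z + 1) := by
      rw [exchange, Equiv.swap_apply_of_ne_of_ne] <;> omega
    rw [hecke_first_succ, hecke_first_succ, h1, h2]
    split_ifs
    · funext y
      simp only [exchange]
      congr 1
      simp only [Equiv.swap_apply_def]
      split_ifs <;> omega
    · rfl

theorem hecke_trunc {i m : ℕ} (h : i < m) (η : Config) :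
    hecke Color.first i (trunc m η) = trunc m (hecke Color.first i η) := by
  cases i with
  | zero =>
    funext y
    simp only [hecke, trunc, Function.update_apply]
    split_ifs <;> first | rfl | omega
  | succ z =>
    have h1 : trunc m η z = η z := if_pos (by omega)
    have h2 : trunc m η (z + 1) = η (z + 1) := if_pos (by omega)
    rw [hecke_first_succ, hecke_first_succ, h1, h2]
    split_ifs
    · funext y
      simp only [exchange, trunc]
      have : Equiv.swap z (z + 1) y < m ↔ y < m := by
        simp only [Equiv.swap_apply_def]
        split_ifs <;> omega
      simp only [this]
    · rfl

theorem hecke_apply_of_lt {i m : ℕ} (h : i < m) (η : Config) :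
    hecke Color.first i η m = η m := by
  cases i with
  | zero => exact Function.update_of_ne (by omega) _ _
  | succ z =>
    rw [hecke_first_succ]
    split_ifs
    · rw [exchange, Equiv.swap_apply_of_ne_of_ne] <;> omega
    · rfl

theorem Admissible.generator_eq {c : Color} {n : ℕ} {K : ℝ} {f : Config → ℝ}
    (h : Admissible c n K f) (α : ℝ) (η : Config) : generator α f η =
      ∑ i ∈ Finset.range (n + 1), rate α i * (f (hecke Color.first i η) - f η) :=
  generator_eq_sum α h.exchange_eq η

theorem Admissible.mono {c : Color} {n n' : ℕ} {K : ℝ} {f : Config → ℝ}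
    (h : Admissible c n K f) (hn : n ≤ n') : Admissible c n' K f where
  bounded := h.bounded
  exchange_eq x hx := h.exchange_eq x (hn.trans hx)
  tendsto := h.tendsto
  trunc_exchange m η hm := h.trunc_exchange m η (hn.trans hm)

/-- Only the letters up to `n` contribute, and they commute with exchanges and truncations further
to the right. Their total rate `α + n` gives the new bound; the cutoff grows by one. -/
theorem Admissible.generator {c : Color} {n : ℕ} {K α : ℝ} (hα : 0 < α) {f : Config → ℝ}
    (h : Admissible c n K f) : Admissible c (n + 1) (2 * (α + n) * K) (generator α f) where
  bounded η := by
    rw [h.generator_eq]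
    calc |∑ i ∈ Finset.range (n + 1), rate α i * (f (hecke Color.first i η) - f η)|
        ≤ ∑ i ∈ Finset.range (n + 1), |rate α i * (f (hecke Color.first i η) - f η)| :=
          Finset.abs_sum_le_sum_abs _ _
      _ ≤ ∑ i ∈ Finset.range (n + 1), rate α i * (2 * K) := by
          refine Finset.sum_le_sum fun i _ => ?_
          rw [abs_mul, abs_of_nonneg (rate_nonneg hα i)]
          refine mul_le_mul_of_nonneg_left ?_ (rate_nonneg hα i)
          have h1 := h.bounded (hecke Color.first i η)
          have h2 := h.bounded η
          have h3 := abs_sub (f (hecke Color.first i η)) (f η)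
          linarith
      _ = 2 * (α + n) * K := by rw [← Finset.sum_mul, sum_rate]; ring
  exchange_eq x hx η := by
    rw [h.generator_eq, h.generator_eq]
    refine Finset.sum_congr rfl fun i hi => ?_
    rw [Finset.mem_range] at hi
    rw [hecke_exchange (by omega), h.exchange_eq x (by omega), h.exchange_eq x (by omega)]
  tendsto η := by
    simp only [h.generator_eq]
    refine tendsto_finsetSum _ fun i _ => ?_
    refine Tendsto.const_mul _ (Tendsto.sub ?_ (h.tendsto η))
    refine (h.tendsto (hecke Color.first i η)).congr' ?_
    filter_upwards [eventually_gt_atTop i] with m hm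
    rw [hecke_trunc hm]
  trunc_exchange m η hm h1 h2 := by
    rw [h.generator_eq, h.generator_eq]
    refine Finset.sum_congr rfl fun i hi => ?_
    rw [Finset.mem_range] at hi
    rw [hecke_trunc (by omega), hecke_trunc (by omega), hecke_exchange (by omega),
      h.trunc_exchange m η (by omega) h1 h2, h.trunc_exchange m _ (by omega)]
    · rwa [hecke_apply_of_lt (by omega)]
    · rwa [hecke_apply_of_lt (by omega)]

/-- The application numbered `j`, counted from `0`, multiplies the bound by `2 * (α + n + j) ≤ 2 *
(α + n + 1) * (j + 1)`. The product is a power times a factorial, the growth allowed in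
`eq_zero_of_iterated_integral`. -/
theorem Admissible.iterate {c : Color} {n : ℕ} {K α : ℝ} (hα : 0 < α) {f : Config → ℝ}
    (h : Admissible c n K f) (k : ℕ) :
    Admissible c (n + k) (K * (2 * (α + n + 1)) ^ k * k.factorial)
      ((HalfLineTASEP.generator α)^[k] f) := by
  induction k with
  | zero => simpa using h
  | succ k ih =>
    rw [Function.iterate_succ_apply']
    have h1 := ih.generator hα
    refine ⟨fun η => (h1.bounded η).trans ?_, h1.exchange_eq, h1.tendsto, h1.trunc_exchange⟩
    have hK : 0 ≤ K := (abs_nonneg _).trans (h.bounded stepInit)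
    have e : K * (2 * (α + n + 1)) ^ (k + 1) * (k + 1).factorial =
        (2 * (α + n + 1) * (k + 1)) * (K * (2 * (α + n + 1)) ^ k * k.factorial) := by
      rw [Nat.factorial_succ]; push_cast; ring
    rw [e]
    refine mul_le_mul_of_nonneg_right ?_ (by positivity)
    push_cast
    have : 0 ≤ (α + n) * k := by positivity
    nlinarith

theorem dependsOn_apply_trunc {f : Config → ℝ} {n : ℕ} (h : DependsOn f (Set.Iio n)) {m : ℕ}
    (hm : n ≤ m) (η : Config) : f (trunc m η) = f η :=
  h fun _ hi => if_pos (lt_of_lt_of_le hi hm)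

theorem dependsOn_trunc (f : Config → ℝ) (m : ℕ) :
    DependsOn (fun η => f (trunc m η)) (Set.Iio m) := by
  intro η η' h
  beta_reduce
  congr 1
  funext i
  simp only [trunc]
  split_ifs with hi
  · exact h i hi
  · rfl

theorem admissible_of_dependsOn (c : Color) {f : Config → ℝ} {n : ℕ} {K : ℝ}
    (h : DependsOn f (Set.Iio n)) (hK : ∀ η, |f η| ≤ K) : Admissible c n K f where
  bounded := hK
  exchange_eq x hx η := h fun i hi => by
    have : i < n := hi
    rw [exchange, Equiv.swap_apply_of_ne_of_ne] <;> omega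
  tendsto η := by
    refine tendsto_const_nhds.congr' ?_
    filter_upwards [eventually_ge_atTop n] with m hm
    exact (dependsOn_apply_trunc h hm η).symm
  trunc_exchange m η hm _ _ := by
    rw [dependsOn_apply_trunc h (by omega), dependsOn_apply_trunc h (by omega)]
    exact h fun i hi => by
      have : i < n := hi
      rw [exchange, Equiv.swap_apply_of_ne_of_ne] <;> omega

theorem dependsOn_generator {α : ℝ} {f : Config → ℝ} {n : ℕ} (h : DependsOn f (Set.Iio n)) :
    DependsOn (generator α f) (Set.Iio (n + 1)) := by
  have hex : ∀ x, n ≤ x → ∀ η, f (exchange η x) = f η := fun x hx η => h fun i hi => by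
    have : i < n := hi
    rw [exchange, Equiv.swap_apply_of_ne_of_ne] <;> omega
  intro η η' hη
  rw [generator_eq_sum α hex, generator_eq_sum α hex]
  refine Finset.sum_congr rfl fun i hi => ?_
  rw [Finset.mem_range] at hi
  have h1 : f η = f η' := h fun i hi => hη i (lt_trans hi (Nat.lt_succ_self n))
  have h2 : f (hecke Color.first i η) = f (hecke Color.first i η') := by
    refine h fun y hy => ?_
    have hy : y < n := hy
    cases i with
    | zero =>
      simp only [hecke, Function.update_apply]
      rw [hη y (Set.mem_Iio.2 (by omega))]
    | succ z =>
      rw [hecke_first_succ, hecke_first_succ, hη z (Set.mem_Iio.2 (by omega)),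
        hη (z + 1) (Set.mem_Iio.2 (by omega))]
      split_ifs
      · refine hη _ ?_
        simp only [Equiv.swap_apply_def, Set.mem_Iio]
        split_ifs <;> omega
      · exact hη _ (Set.mem_Iio.2 (by omega))
  rw [h1, h2]

open Classical in
/-- The indicator function of having `s` particles of class `c`. -/
def countIndicator (c : Color) (s : ℕ) (η : Config) : ℝ :=
  if {i | η i = c}.encard = s then 1 else 0

/-- Exchanges preserve the count, so the cutoff is `0`. If the count is infinite, long truncations
contain at least `s + 1` particles and the indicator vanishes. Holes are excluded because truncation
creates them. -/
theorem admissible_countIndicator {c : Color} (hc : c ≠ Color.hole) (s : ℕ) :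
    Admissible c 0 1 (countIndicator c s) where
  bounded η := by
    rw [countIndicator]
    split_ifs <;> simp
  exchange_eq x _ η := by
    rw [countIndicator, countIndicator]
    have : {i | exchange η x i = c} = Equiv.swap x (x + 1) ⁻¹' {i | η i = c} := rfl
    rw [this, Set.encard_preimage_of_bijective (Equiv.bijective _)]
  tendsto η := by
    refine tendsto_const_nhds.congr' ?_
    have hset : ∀ m, {i | trunc m η i = c} = {i | i < m ∧ η i = c} := by
      intro m
      ext i
      simp only [trunc, Set.mem_ofPred_eq]
      split_ifs with h
      · simp [h]
      · simp [h, hc.symm]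
    by_cases hfin : {i | η i = c}.Finite
    · obtain ⟨B, hB⟩ := hfin.bddAbove
      filter_upwards [eventually_gt_atTop B] with m hm
      have : {i | i < m ∧ η i = c} = {i | η i = c} :=
        Set.ext fun i => ⟨fun h => h.2, fun h => ⟨(hB h).trans_lt hm, h⟩⟩
      rw [countIndicator, countIndicator, hset, this]
    · have hinf : {i | η i = c}.Infinite := hfin
      obtain ⟨t, ht, hts⟩ := hinf.exists_subset_card_eq (s + 1)
      filter_upwards [eventually_gt_atTop (t.sup id)] with m hm
      rw [countIndicator, countIndicator, hset, hinf.encard_eq, if_neg (by simp), if_neg]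
      intro h
      have hsub : (t : Set ℕ) ⊆ {i | i < m ∧ η i = c} := fun i hi =>
        ⟨(Finset.le_sup (f := id) hi).trans_lt hm, ht hi⟩
      have h2 := Set.encard_le_encard hsub
      rw [Set.encard_coe_eq_coe_finsetCard, hts, h] at h2
      have := ENat.natCast_le_natCast.1 h2
      omega
  trunc_exchange m η _ h1 h2 := by
    rw [countIndicator, countIndicator]
    have : {i | trunc (m + 1) (exchange η m) i = c} = {i | trunc (m + 1) η i = c} := by
      ext i
      simp only [Set.mem_ofPred_eq, trunc, exchange]
      split_ifs with hi
      · rcases eq_or_ne i m with rfl | hne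
        · simp [h1, h2]
        · rw [Equiv.swap_apply_of_ne_of_ne hne (by omega)]
      · rfl
    rw [this]

/-! ### Reversal of words -/

/-- The generator acting by appending letters. -/
def appendGenerator (α : ℝ) (n : ℕ) (H : List ℕ → ℝ) (u : List ℕ) : ℝ :=
  ∑ i ∈ Finset.range n, rate α i * (H (u ++ [i]) - H u)

/-- The generator acting by prepending letters. -/
def prependGenerator (α : ℝ) (n : ℕ) (H : List ℕ → ℝ) (u : List ℕ) : ℝ :=
  ∑ i ∈ Finset.range n, rate α i * (H (i :: u) - H u)

theorem appendGenerator_commute (α : ℝ) (n : ℕ) :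
    Function.Commute (appendGenerator α n) (prependGenerator α n) := by
  intro H
  funext u
  simp only [appendGenerator, prependGenerator, Finset.mul_sum, ← Finset.sum_sub_distrib,
    List.cons_append]
  rw [Finset.sum_comm]
  refine Finset.sum_congr rfl fun i _ => Finset.sum_congr rfl fun j _ => ?_
  ring

/-- On the empty word the two operations coincide, and commutation carries this over to powers. This
is invariance under word reversal, at the level of time derivatives. -/
theorem iterate_appendGenerator_nil (α : ℝ) (n k : ℕ) (H : List ℕ → ℝ) :
    (appendGenerator α n)^[k] H [] = (prependGenerator α n)^[k] H [] := by
  induction k generalizing H with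
  | zero => rfl
  | succ k ih =>
    have h1 : ∀ H', appendGenerator α n H' [] = prependGenerator α n H' [] := fun H' => rfl
    rw [Function.iterate_succ_apply', h1,
      ← ((appendGenerator_commute α n).iterate_left k) H, ih, Function.iterate_succ_apply]

theorem Admissible.iterate_generator_act {c : Color} {n : ℕ} {K α : ℝ} (hα : 0 < α)
    {f : Config → ℝ} (h : Admissible c n K f) {m k : ℕ} (hk : n + k ≤ m) (η : Config)
    (u : List ℕ) :
    (HalfLineTASEP.generator α)^[k] f (act Color.first u η) =
      (appendGenerator α (m + 1))^[k] (fun u => f (act Color.first u η)) u := by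
  induction k generalizing u with
  | zero => rfl
  | succ k ih =>
    rw [Function.iterate_succ_apply', Function.iterate_succ_apply', appendGenerator,
      ((h.iterate hα k).mono (by omega : n + k ≤ m)).generator_eq]
    simp only [← ih (by omega), act_append, act_cons, act_nil]

theorem Admissible.iterate_generator_act_reverse {c : Color} {n : ℕ} {K α : ℝ} (hα : 0 < α)
    {f : Config → ℝ} (h : Admissible c n K f) {m k : ℕ} (hk : n + k ≤ m) (η : Config)
    (u : List ℕ) :
    (HalfLineTASEP.generator α)^[k] f (act Color.first u.reverse η) =
      (prependGenerator α (m + 1))^[k] (fun u => f (act Color.first u.reverse η)) u := by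
  induction k generalizing u with
  | zero => rfl
  | succ k ih =>
    rw [Function.iterate_succ_apply', Function.iterate_succ_apply', prependGenerator,
      ((h.iterate hα k).mono (by omega : n + k ≤ m)).generator_eq]
    simp only [← ih (by omega), List.reverse_cons, act_append, act_cons, act_nil]

theorem iterate_generator_eq_of_reverse {c c' : Color} {n n' : ℕ} {K K' α : ℝ} (hα : 0 < α)
    {f g : Config → ℝ} (hf : Admissible c n K f) (hg : Admissible c' n' K' g) {η η' : Config}
    (h : ∀ u, f (act Color.first u η) = g (act Color.first u.reverse η')) (k : ℕ) :
    (generator α)^[k] f η = (generator α)^[k] g η' := by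
  -- The cutoff `n + n' + k` makes both sides sums over words in the same finite alphabet;
  -- superfluous letters contribute nothing.
  have h1 := hf.iterate_generator_act hα (m := n + n' + k) (k := k) (by omega) η []
  have h2 := hg.iterate_generator_act_reverse hα (m := n + n' + k) (k := k) (by omega) η' []
  rw [act_nil] at h1
  rw [List.reverse_nil, act_nil] at h2
  rw [h1, h2, iterate_appendGenerator_nil]
  simp only [h]

/-! ### Measurability -/

theorem finite_color : Finite Color :=
  Finite.of_injective (fun c : Color => (⟨c.rank, by cases c <;> simp [Color.rank]⟩ : Fin 5))
    fun a b h => Color.rank_injective (by simpa using h)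

theorem measurable_of_dependsOn {f : Config → ℝ} {n : ℕ} (h : DependsOn f (Set.Iio n)) :
    Measurable f := by
  have := finite_color
  have : DiscreteMeasurableSpace Color := ⟨fun _ => trivial⟩
  set g : (Fin n → Color) → ℝ := fun ζ => f fun i => if hi : i < n then ζ ⟨i, hi⟩ else Color.hole
  have hg : Measurable g := Measurable.of_discrete
  have : f = g ∘ fun η (i : Fin n) => η i := by
    funext η
    refine h fun i hi => ?_
    have hi : i < n := hi
    simp [hi]
  rw [this]
  exact hg.comp (measurable_pi_lambda _ fun i => measurable_pi_apply _)

theorem Admissible.measurable {c : Color} {n : ℕ} {K : ℝ} {f : Config → ℝ}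
    (h : Admissible c n K f) : Measurable f :=
  measurable_of_tendsto_metrizable (fun m => measurable_of_dependsOn (dependsOn_trunc f m))
    (tendsto_pi_nhds.2 h.tendsto)

/-! ### Expectations and the Kolmogorov equation for local functions -/

section Expectation

variable {Ω : Type*} [MeasurableSpace Ω] {P : Measure Ω} {α : ℝ} {η₀ : Config}
  {X : ℝ≥0 → Ω → Config}

/-- The expectation of `f` at time `s`. -/
def mean (P : Measure Ω) (X : ℝ≥0 → Ω → Config) (f : Config → ℝ) (s : ℝ) : ℝ :=
  ∫ ω, f (X s.toNNReal ω) ∂P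

theorem IsTASEP.measurable (hX : IsTASEP P α η₀ X) (t : ℝ≥0) : Measurable (X t) := by
  obtain ⟨ℱ, h, -⟩ := hX.martingale
  exact (h t).mono (ℱ.le t) le_rfl

theorem IsTASEP.measurable_comp_countable (hX : IsTASEP P α η₀ X) {f : Config → ℝ}
    (hf : Measurable f) (T : ℕ → ℝ≥0) {J : ℝ → ℕ} (hJ : Measurable J) :
    Measurable fun q : ℝ × Ω => f (X (T (J q.1)) q.2) := by
  have h1 : Measurable fun q : ℕ × Ω => f (X (T q.1) q.2) :=
    measurable_from_prod_countable_right fun j => hf.comp (hX.measurable (T j))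
  have h2 : Measurable fun q : ℝ × Ω => (J q.1, q.2) :=
    (hJ.comp measurable_fst).prodMk measurable_snd
  exact h1.comp h2

/-- By right continuity the value at `s` is the limit of the values at the grid times `(⌊s(k + 1)⌋ +
1) / (k + 1)`, which lie strictly to the right of `s` and take countably many values. -/
theorem IsTASEP.measurable_uncurry (hX : IsTASEP P α η₀ X) {f : Config → ℝ} {n : ℕ}
    (h : DependsOn f (Set.Iio n)) :
    Measurable fun q : ℝ × Ω => f (X q.1.toNNReal q.2) := by
  have hf := measurable_of_dependsOn h
  set T : ℕ → ℕ → ℝ≥0 := fun k j => ((j : ℝ≥0) + 1) / (k + 1) with hT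
  set J : ℕ → ℝ → ℕ := fun k s => ⌊s.toNNReal * (k + 1)⌋₊ with hJ
  refine measurable_of_tendsto_metrizable
    (f := fun (k : ℕ) (q : ℝ × Ω) => f (X (T k (J k q.1)) q.2)) ?_ ?_
  · intro k
    refine hX.measurable_comp_countable hf (T k) ?_
    exact Nat.measurable_floor.comp (measurable_real_toNNReal.mul_const _)
  · rw [tendsto_pi_nhds]
    rintro ⟨s, ω⟩
    have h1 : Tendsto (fun k => T k (J k s)) atTop (𝓝[>] s.toNNReal) := by
      rw [tendsto_nhdsWithin_iff]
      constructor
      · have hu : Tendsto (fun k : ℕ => s.toNNReal + 1 / ((k : ℝ≥0) + 1)) atTop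
            (𝓝 (s.toNNReal + 0)) :=
          tendsto_const_nhds.add tendsto_one_div_add_atTop_nhds_zero_nat
        rw [add_zero] at hu
        refine tendsto_of_tendsto_of_tendsto_of_le_of_le tendsto_const_nhds hu ?_ ?_
        · intro k
          simp only [hT, hJ]
          rw [le_div_iff₀ (by positivity)]
          exact (Nat.lt_floor_add_one _).le
        · intro k
          simp only [hT, hJ]
          rw [div_le_iff₀ (by positivity), add_mul, div_mul_cancel₀ _ (by positivity)]
          gcongr
          exact Nat.floor_le zero_le
      · refine Eventually.of_forall fun k => ?_
        simp only [hT, hJ, Set.mem_Ioi]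
        rw [lt_div_iff₀ (by positivity)]
        exact Nat.lt_floor_add_one _
    have h2 : ∀ᶠ r in 𝓝[>] s.toNNReal, ∀ i ∈ Finset.range n, X r ω i = X s.toNNReal ω i :=
      (Filter.eventually_all_finset _).2 fun i _ => hX.right_continuous ω i _
    refine tendsto_const_nhds.congr' ?_
    filter_upwards [h1.eventually h2] with k hk
    exact (h fun i hi => hk i (Finset.mem_range.2 hi)).symm

variable [IsProbabilityMeasure P]

theorem abs_mean_le {f : Config → ℝ} {K : ℝ} (hf : ∀ η, |f η| ≤ K) (s : ℝ) :
    |mean P X f s| ≤ K := by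
  have := norm_integral_le_of_norm_le_const (μ := P) (f := fun ω => f (X s.toNNReal ω)) (C := K)
    (Eventually.of_forall fun ω => hf _)
  simpa [mean] using this

theorem IsTASEP.integrable (hX : IsTASEP P α η₀ X) {f : Config → ℝ} (hf : Measurable f) {K : ℝ}
    (hK : ∀ η, |f η| ≤ K) (t : ℝ≥0) : Integrable (fun ω => f (X t ω)) P :=
  Integrable.of_bound (hf.comp (hX.measurable t)).aestronglyMeasurable K
    (Eventually.of_forall fun _ => hK _)

theorem IsTASEP.measurable_mean_of_dependsOn (hX : IsTASEP P α η₀ X) {f : Config → ℝ} {n : ℕ}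
    (h : DependsOn f (Set.Iio n)) : Measurable (mean P X f) :=
  ((hX.measurable_uncurry h).stronglyMeasurable.integral_prod_right (ν := P)).measurable

theorem IsTASEP.mean_zero (hX : IsTASEP P α η₀ X) (f : Config → ℝ) : mean P X f 0 = f η₀ := by
  simp [mean, hX.initial]

theorem intervalIntegrable_of_bound {g : ℝ → ℝ} (hg : Measurable g) {K : ℝ}
    (hK : ∀ s, |g s| ≤ K) (a b : ℝ) : IntervalIntegrable g volume a b := by
  rw [intervalIntegrable_iff, Set.uIoc]
  refine Integrable.of_bound hg.aestronglyMeasurable K (Eventually.of_forall hK)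

/-- The Kolmogorov equation for functions of finitely many sites. -/
theorem IsTASEP.mean_eq_of_dependsOn (hα : 0 < α) (hX : IsTASEP P α η₀ X) {f : Config → ℝ}
    {n : ℕ} {K : ℝ} (h : DependsOn f (Set.Iio n)) (hK : ∀ η, |f η| ≤ K) {t : ℝ} (ht : 0 ≤ t) :
    mean P X f t = f η₀ + ∫ s in (0 : ℝ)..t, mean P X (generator α f) s := by
  lift t to ℝ≥0 using ht
  have hG := dependsOn_generator (α := α) h
  have hGK := ((admissible_of_dependsOn Color.hole h hK).generator hα).bounded
  obtain ⟨ℱ, -, hM⟩ := hX.martingale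
  have hmart := hM f ⟨n, h⟩
  -- The martingale is zero at time `0`, hence has mean zero at time `t`; Fubini then moves the
  -- expectation inside the time integral.
  have h1 := hmart.setIntegral_eq (zero_le (a := t)) (MeasurableSet.univ (m := ℱ 0))
  rw [setIntegral_univ, setIntegral_univ] at h1
  have hint : Integrable (Function.uncurry fun (s : ℝ) ω => generator α f (X s.toNNReal ω))
      ((volume.restrict (Set.Ioc (0 : ℝ) t)).prod P) :=
    Integrable.of_bound (hX.measurable_uncurry hG).aestronglyMeasurable _
      (Eventually.of_forall fun q => hGK _)
  have hint' : Integrable (fun ω => ∫ s in (0 : ℝ)..t, generator α f (X s.toNNReal ω)) P := by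
    simp only [intervalIntegral.integral_of_le t.coe_nonneg]
    exact hint.integral_prod_right
  have hfi := hX.integrable (measurable_of_dependsOn h) hK
  have h2 : ∫ ω, (∫ s in (0 : ℝ)..t, generator α f (X s.toNNReal ω)) ∂P =
      ∫ s in (0 : ℝ)..t, mean P X (generator α f) s := by
    simp only [intervalIntegral.integral_of_le t.coe_nonneg]
    rw [← integral_integral_swap hint]
    rfl
  have h4 : ∫ ω, (f (X t ω) - f (X 0 ω) - ∫ s in (0 : ℝ)..t, generator α f (X s.toNNReal ω)) ∂P =
      ∫ ω, f (X t ω) ∂P - f η₀ - ∫ s in (0 : ℝ)..t, mean P X (generator α f) s := by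
    rw [integral_sub _ hint', h2, integral_sub (hfi t) (hfi 0)]
    · simp [hX.initial]
    · exact (hfi t).sub (hfi 0)
  rw [h4] at h1
  simp only [sub_self, NNReal.coe_zero, intervalIntegral.integral_same, integral_zero] at h1
  have h3 : mean P X f t = ∫ ω, f (X t ω) ∂P := by simp [mean]
  rw [h3]
  linarith

end Expectation

section Expectation

variable {Ω : Type*} [MeasurableSpace Ω] {P : Measure Ω} [IsProbabilityMeasure P] {α : ℝ}
  {η₀ : Config} {X : ℝ≥0 → Ω → Config}

/-! ### Finite speed of propagation -/

open Classical in
/-- The indicator function of having a particle of class `c` at site `i`. -/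
def siteIndicator (c : Color) (i : ℕ) (η : Config) : ℝ := if η i = c then 1 else 0

theorem dependsOn_siteIndicator (c : Color) (i : ℕ) :
    DependsOn (siteIndicator c i) (Set.Iio (i + 1)) := by
  intro η η' h
  simp only [siteIndicator, h i (Set.mem_Iio.2 (Nat.lt_succ_self i))]

theorem siteIndicator_nonneg (c : Color) (i : ℕ) (η : Config) : 0 ≤ siteIndicator c i η := by
  rw [siteIndicator]
  split_ifs <;> norm_num

theorem siteIndicator_le_one (c : Color) (i : ℕ) (η : Config) : siteIndicator c i η ≤ 1 := by
  rw [siteIndicator]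
  split_ifs <;> norm_num

theorem abs_siteIndicator_le (c : Color) (i : ℕ) (η : Config) : |siteIndicator c i η| ≤ 1 := by
  rw [abs_of_nonneg (siteIndicator_nonneg c i η)]
  exact siteIndicator_le_one c i η

/-- A particle of class `c` can enter a site other than the first only from one of its two
neighbors, each time at rate at most `1`. -/
theorem generator_siteIndicator_le (c : Color) (i : ℕ) (η : Config) :
    generator α (siteIndicator c (i + 1)) η ≤ siteIndicator c i η + siteIndicator c (i + 2) η := by
  have h := admissible_of_dependsOn c (dependsOn_siteIndicator c (i + 1))
    (abs_siteIndicator_le c (i + 1))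
  rw [h.generator_eq, Finset.sum_range_succ, Finset.sum_range_succ, Finset.sum_eq_zero, zero_add]
  · refine add_le_add ?_ ?_
    · rw [rate, one_mul, hecke_first_succ]
      split_ifs
      · have : siteIndicator c (i + 1) (exchange η i) = siteIndicator c i η := by
          simp [siteIndicator, exchange]
        rw [this]
        linarith [siteIndicator_nonneg c (i + 1) η]
      · linarith [siteIndicator_nonneg c i η]
    · rw [rate, one_mul, hecke_first_succ]
      split_ifs
      · have : siteIndicator c (i + 1) (exchange η (i + 1)) = siteIndicator c (i + 2) η := by
          simp [siteIndicator, exchange]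
        rw [this]
        linarith [siteIndicator_nonneg c (i + 1) η]
      · linarith [siteIndicator_nonneg c (i + 2) η]
  · intro j hj
    rw [Finset.mem_range] at hj
    have : siteIndicator c (i + 1) (hecke Color.first j η) = siteIndicator c (i + 1) η := by
      rw [siteIndicator, siteIndicator, hecke_apply_of_lt hj]
    rw [this, sub_self, mul_zero]

theorem mean_mono (hX : IsTASEP P α η₀ X) {f g : Config → ℝ} (hf : Measurable f)
    (hg : Measurable g) {K K' : ℝ} (hK : ∀ η, |f η| ≤ K) (hK' : ∀ η, |g η| ≤ K')
    (h : ∀ η, f η ≤ g η) (s : ℝ) : mean P X f s ≤ mean P X g s :=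
  integral_mono (hX.integrable hf hK _) (hX.integrable hg hK' _) fun _ => h _

/-- Each use of the Kolmogorov equation costs one site of distance from the initial particles and
gains one time integration; the factor `2` counts the two neighbors. -/
theorem mean_siteIndicator_le (hα : 0 < α) (hX : IsTASEP P α η₀ X) {c : Color} {l : ℕ}
    (hl : ∀ i, l ≤ i → η₀ i ≠ c) (k : ℕ) : ∀ i, l + k ≤ i → ∀ t, 0 ≤ t →
      mean P X (siteIndicator c i) t ≤ (2 * t) ^ k / k.factorial := by
  induction k with
  | zero =>
    intro i _ t _
    have := abs_mean_le (P := P) (X := X) (abs_siteIndicator_le c i) t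
    simpa using (le_abs_self _).trans this
  | succ k ih =>
    intro i hi t ht
    obtain ⟨j, rfl⟩ : ∃ j, i = j + 1 := ⟨i - 1, by omega⟩
    have hd := dependsOn_siteIndicator c (j + 1)
    have hG := dependsOn_generator (α := α) hd
    have hGK := ((admissible_of_dependsOn c hd (abs_siteIndicator_le c (j + 1))).generator
      hα).bounded
    rw [hX.mean_eq_of_dependsOn hα hd (abs_siteIndicator_le c (j + 1)) ht]
    have h0 : siteIndicator c (j + 1) η₀ = 0 := if_neg (hl _ (by omega))
    rw [h0, zero_add]
    calc ∫ s in (0 : ℝ)..t, mean P X (generator α (siteIndicator c (j + 1))) s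
        ≤ ∫ s in (0 : ℝ)..t, 2 * ((2 * s) ^ k / k.factorial) := by
          refine intervalIntegral.integral_mono_on ht ?_ ?_ ?_
          · exact intervalIntegrable_of_bound (hX.measurable_mean_of_dependsOn hG)
              (abs_mean_le hGK) _ _
          · exact Continuous.intervalIntegrable (by fun_prop) _ _
          · intro s hs
            have h1 := ih j (by omega) s hs.1
            have h2 := ih (j + 2) (by omega) s hs.1
            have m1 := measurable_of_dependsOn (dependsOn_siteIndicator c j)
            have m2 := measurable_of_dependsOn (dependsOn_siteIndicator c (j + 2))
            have h3 : mean P X (generator α (siteIndicator c (j + 1))) s ≤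
                mean P X (fun η => siteIndicator c j η + siteIndicator c (j + 2) η) s := by
              refine mean_mono hX (measurable_of_dependsOn hG) (m1.add m2) hGK (K' := 1 + 1) ?_
                (generator_siteIndicator_le c j) s
              intro η
              exact (abs_add_le _ _).trans
                (add_le_add (abs_siteIndicator_le _ _ _) (abs_siteIndicator_le _ _ _))
            have h4 : mean P X (fun η => siteIndicator c j η + siteIndicator c (j + 2) η) s =
                mean P X (siteIndicator c j) s + mean P X (siteIndicator c (j + 2)) s :=
              integral_add (hX.integrable m1 (abs_siteIndicator_le c j) _)
                (hX.integrable m2 (abs_siteIndicator_le c (j + 2)) _)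
            linarith
      _ = (2 * t) ^ (k + 1) / (k + 1).factorial := by
          simp only [mul_pow]
          rw [intervalIntegral.integral_const_mul, intervalIntegral.integral_div,
            intervalIntegral.integral_const_mul, integral_pow, Nat.factorial_succ]
          have : (k.factorial : ℝ) ≠ 0 := by positivity
          have : ((k : ℝ) + 1) ≠ 0 := by positivity
          push_cast
          field_simp
          simp
          ring

theorem tendsto_mean_siteIndicator (hα : 0 < α) (hX : IsTASEP P α η₀ X) {c : Color} {l : ℕ}
    (hl : ∀ i, l ≤ i → η₀ i ≠ c) {t : ℝ} (ht : 0 ≤ t) :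
    Tendsto (fun i => mean P X (siteIndicator c i) t) atTop (𝓝 0) := by
  rw [← tendsto_add_atTop_iff_nat l]
  refine squeeze_zero (fun k => integral_nonneg fun _ => siteIndicator_nonneg _ _ _)
    (fun k => mean_siteIndicator_le hα hX hl k (k + l) (by omega) t ht) ?_
  exact FloorSemiring.tendsto_pow_div_factorial_atTop (2 * t)

/-! ### The Kolmogorov equation for admissible functions -/

theorem Admissible.tendsto_mean_trunc {c : Color} {n : ℕ} {K : ℝ} {f : Config → ℝ}
    (h : Admissible c n K f) (hX : IsTASEP P α η₀ X) (t : ℝ) :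
    Tendsto (fun m => mean P X (fun η => f (trunc m η)) t) atTop (𝓝 (mean P X f t)) := by
  refine tendsto_integral_of_dominated_convergence (fun _ => K) ?_ (integrable_const _) ?_ ?_
  · intro m
    exact ((measurable_of_dependsOn (dependsOn_trunc f m)).comp
      (hX.measurable _)).aestronglyMeasurable
  · exact fun m => Eventually.of_forall fun ω => h.bounded _
  · exact Eventually.of_forall fun ω => h.tendsto _

theorem Admissible.measurable_mean {c : Color} {n : ℕ} {K : ℝ} {f : Config → ℝ}
    (h : Admissible c n K f) (hX : IsTASEP P α η₀ X) : Measurable (mean P X f) :=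
  measurable_of_tendsto_metrizable
    (fun m => hX.measurable_mean_of_dependsOn (dependsOn_trunc f m))
    (tendsto_pi_nhds.2 fun t => h.tendsto_mean_trunc hX t)

/-- Truncation commutes with every letter except the one across the cutoff, and that letter is
invisible to the truncated function unless class `c` is present at one of its two sites. -/
theorem Admissible.abs_generator_trunc_sub_le {c : Color} {n : ℕ} {K : ℝ} {f : Config → ℝ}
    (h : Admissible c n K f) {m : ℕ} (hm : n ≤ m) (η : Config) :
    |HalfLineTASEP.generator α (fun η => f (trunc (m + 1) η)) η -
        HalfLineTASEP.generator α f (trunc (m + 1) η)| ≤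
      2 * K * (siteIndicator c m η + siteIndicator c (m + 1) η) := by
  have hK : 0 ≤ K := (abs_nonneg _).trans (h.bounded stepInit)
  have hb : ∀ x, m + 1 ≤ x → ∀ η, f (trunc (m + 1) (exchange η x)) = f (trunc (m + 1) η) :=
    fun x hx η => dependsOn_trunc f (m + 1) fun i hi => by
      have : i < m + 1 := hi
      rw [exchange, Equiv.swap_apply_of_ne_of_ne] <;> omega
  rw [generator_eq_sum α hb, (h.mono hm).generator_eq, Finset.sum_range_succ]
  have h1 : ∀ i ∈ Finset.range (m + 1),
      rate α i * (f (trunc (m + 1) (hecke Color.first i η)) - f (trunc (m + 1) η)) =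
      rate α i * (f (hecke Color.first i (trunc (m + 1) η)) - f (trunc (m + 1) η)) := by
    intro i hi
    rw [hecke_trunc (Finset.mem_range.1 hi)]
  rw [Finset.sum_congr rfl h1, add_sub_cancel_left, rate, one_mul, hecke_first_succ]
  have hs := siteIndicator_nonneg c m η
  have hs' := siteIndicator_nonneg c (m + 1) η
  by_cases hc : η m ≠ c ∧ η (m + 1) ≠ c
  · have : f (trunc (m + 1) (if η m < η (m + 1) then exchange η m else η)) =
        f (trunc (m + 1) η) := by
      split_ifs
      · exact h.trunc_exchange m η hm hc.1 hc.2
      · rfl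
    rw [this, sub_self, abs_zero]
    positivity
  · have h2 : 1 ≤ siteIndicator c m η + siteIndicator c (m + 1) η := by
      by_cases h3 : η m = c
      · have : siteIndicator c m η = 1 := if_pos h3
        linarith
      · have : siteIndicator c (m + 1) η = 1 := if_pos (by tauto)
        linarith
    have h3 := abs_sub (f (trunc (m + 1) (if η m < η (m + 1) then exchange η m else η)))
      (f (trunc (m + 1) η))
    have h4 := h.bounded (trunc (m + 1) (if η m < η (m + 1) then exchange η m else η))
    have h5 := h.bounded (trunc (m + 1) η)
    nlinarith

/-- The equation holds for the truncated functions. The error in their generators is controlled by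
the probability of class `c` near the cutoff, which tends to zero by finite speed of propagation. -/
theorem Admissible.mean_eq (hα : 0 < α) {c : Color} {n : ℕ} {K : ℝ} {f : Config → ℝ}
    (h : Admissible c n K f) (hX : IsTASEP P α η₀ X) {l : ℕ} (hl : ∀ i, l ≤ i → η₀ i ≠ c)
    {t : ℝ} (ht : 0 ≤ t) :
    mean P X f t = f η₀ + ∫ s in (0 : ℝ)..t, mean P X (HalfLineTASEP.generator α f) s := by
  have hg := h.generator hα
  set B : ℝ := 2 * (α + n) * K + 2 * K * (1 + 1)
  have hK : 0 ≤ K := (abs_nonneg _).trans (h.bounded stepInit)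
  have hd : ∀ m, DependsOn (HalfLineTASEP.generator α fun η => f (trunc (m + 1) η))
      (Set.Iio (m + 1 + 1)) := fun m => dependsOn_generator (dependsOn_trunc f (m + 1))
  have hB : ∀ m, n ≤ m → ∀ η,
      |HalfLineTASEP.generator α (fun η => f (trunc (m + 1) η)) η| ≤ B := by
    intro m hm η
    have h1 := h.abs_generator_trunc_sub_le (α := α) hm η
    have h2 := hg.bounded (trunc (m + 1) η)
    have h3 := siteIndicator_le_one c m η
    have h4 := siteIndicator_le_one c (m + 1) η
    have h5 : 2 * K * (siteIndicator c m η + siteIndicator c (m + 1) η) ≤ 2 * K * (1 + 1) := by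
      gcongr
    have h6 := abs_sub_abs_le_abs_sub (HalfLineTASEP.generator α (fun η => f (trunc (m + 1) η)) η)
      (HalfLineTASEP.generator α f (trunc (m + 1) η))
    simp only [B]
    linarith
  have hpt : ∀ s, 0 ≤ s → Tendsto
      (fun m => mean P X (HalfLineTASEP.generator α fun η => f (trunc (m + 1) η)) s) atTop
      (𝓝 (mean P X (HalfLineTASEP.generator α f) s)) := by
    intro s hs
    have h1 := (hg.tendsto_mean_trunc hX s).comp (tendsto_add_atTop_nat 1)
    have h2 := tendsto_mean_siteIndicator hα hX hl hs
    have h3 := ((h2.add (h2.comp (tendsto_add_atTop_nat 1))).const_mul (2 * K))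
    rw [add_zero, mul_zero] at h3
    refine h1.congr_dist (squeeze_zero' (Eventually.of_forall fun _ => dist_nonneg) ?_ h3)
    filter_upwards [eventually_ge_atTop n] with m hm
    rw [dist_comm, Real.dist_eq]
    have m1 := measurable_of_dependsOn (dependsOn_siteIndicator c m)
    have m2 := measurable_of_dependsOn (dependsOn_siteIndicator c (m + 1))
    have i1 := hX.integrable m1 (abs_siteIndicator_le c m) s.toNNReal
    have i2 := hX.integrable m2 (abs_siteIndicator_le c (m + 1)) s.toNNReal
    have i3 := hX.integrable (measurable_of_dependsOn (hd m)) (hB m hm) s.toNNReal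
    have i4 := hX.integrable (measurable_of_dependsOn (dependsOn_trunc
      (HalfLineTASEP.generator α f) (m + 1))) (fun η => hg.bounded _) s.toNNReal
    have h4 : 2 * K * (mean P X (siteIndicator c m) s + mean P X (siteIndicator c (m + 1)) s) =
        ∫ ω, 2 * K * (siteIndicator c m (X s.toNNReal ω) +
          siteIndicator c (m + 1) (X s.toNNReal ω)) ∂P := by
      rw [integral_const_mul, integral_add i1 i2]
      rfl
    simp only [Function.comp_apply]
    rw [h4, mean, mean, ← integral_sub i3 i4, ← Real.norm_eq_abs]
    refine norm_integral_le_of_norm_le ((i1.add i2).const_mul (2 * K)) ?_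
    exact Eventually.of_forall fun ω => h.abs_generator_trunc_sub_le hm _
  have hloc : ∀ m, mean P X (fun η => f (trunc (m + 1) η)) t = f (trunc (m + 1) η₀) +
      ∫ s in (0 : ℝ)..t,
        mean P X (HalfLineTASEP.generator α fun η => f (trunc (m + 1) η)) s :=
    fun m => hX.mean_eq_of_dependsOn hα (dependsOn_trunc f (m + 1)) (fun η => h.bounded _) ht
  have hL := (h.tendsto_mean_trunc hX t).comp (tendsto_add_atTop_nat 1)
  have hR : Tendsto (fun m => f (trunc (m + 1) η₀) + ∫ s in (0 : ℝ)..t,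
      mean P X (HalfLineTASEP.generator α fun η => f (trunc (m + 1) η)) s) atTop
      (𝓝 (f η₀ + ∫ s in (0 : ℝ)..t, mean P X (HalfLineTASEP.generator α f) s)) := by
    refine Tendsto.add ((h.tendsto η₀).comp (tendsto_add_atTop_nat 1)) ?_
    refine intervalIntegral.tendsto_integral_filter_of_dominated_convergence (fun _ => B) ?_ ?_
      intervalIntegrable_const ?_
    · exact Eventually.of_forall fun m =>
        (hX.measurable_mean_of_dependsOn (hd m)).aestronglyMeasurable
    · filter_upwards [eventually_ge_atTop n] with m hm
      exact Eventually.of_forall fun s _ => abs_mean_le (hB m hm) s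
    · refine Eventually.of_forall fun s hs => hpt s ?_
      rw [Set.uIoc_of_le ht] at hs
      exact hs.1.le
  refine tendsto_nhds_unique hL (hR.congr fun m => ?_)
  rw [← hloc m]
  rfl

theorem Admissible.iterate_mean_eq (hα : 0 < α) {c : Color} {n : ℕ} {K : ℝ} {f : Config → ℝ}
    (h : Admissible c n K f) (hX : IsTASEP P α η₀ X) {l : ℕ} (hl : ∀ i, l ≤ i → η₀ i ≠ c)
    (k : ℕ) {s t : ℝ} (hs : 0 ≤ s) (hst : s ≤ t) :
    mean P X ((HalfLineTASEP.generator α)^[k] f) t =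
      mean P X ((HalfLineTASEP.generator α)^[k] f) s +
        ∫ u in s..t, mean P X ((HalfLineTASEP.generator α)^[k + 1] f) u := by
  have hk := h.iterate hα k
  have hi := intervalIntegrable_of_bound ((h.iterate hα (k + 1)).measurable_mean hX)
    (abs_mean_le (h.iterate hα (k + 1)).bounded)
  rw [hk.mean_eq hα hX hl hs, hk.mean_eq hα hX hl (hs.trans hst),
    ← Function.iterate_succ_apply' (HalfLineTASEP.generator α) k f, add_assoc,
    intervalIntegral.integral_add_adjacent_intervals (hi 0 s) (hi s t)]

end Expectation

/-- Duality: if words act on `f` and `η` as the reversed words act on `g` and `η'`, then the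
expectations of `f` and `g` agree at all times. -/
theorem mean_eq_of_reverse {Ω Ω' : Type*} [MeasurableSpace Ω] [MeasurableSpace Ω'] {P : Measure Ω}
    [IsProbabilityMeasure P] {P' : Measure Ω'} [IsProbabilityMeasure P'] {α : ℝ} (hα : 0 < α)
    {η η' : Config} {X : ℝ≥0 → Ω → Config} {X' : ℝ≥0 → Ω' → Config} (hX : IsTASEP P α η X)
    (hX' : IsTASEP P' α η' X') {c c' : Color} {l l' : ℕ} (hl : ∀ i, l ≤ i → η i ≠ c)
    (hl' : ∀ i, l' ≤ i → η' i ≠ c') {n n' : ℕ} {K K' : ℝ} {f g : Config → ℝ}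
    (hf : Admissible c n K f) (hg : Admissible c' n' K' g)
    (h : ∀ u, f (act Color.first u η) = g (act Color.first u.reverse η')) (t : ℝ≥0) :
    mean P X f t = mean P' X' g t := by
  -- With a common cutoff one constant `R` bounds the derivatives of both expectations.
  have hf := hf.mono (Nat.le_add_right n n')
  have hg := hg.mono (Nat.le_add_left n' n)
  have key := eq_zero_of_iterated_integral
    (ψ := fun k t => mean P X ((generator α)^[k] f) t - mean P' X' ((generator α)^[k] g) t)
    (C := K + K') (R := 2 * (α + (n + n' : ℕ) + 1)) (by positivity) ?_ ?_ ?_ 0 t t.coe_nonneg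
  · simpa [sub_eq_zero] using key
  · intro k s t hs hst
    rw [hf.iterate_mean_eq hα hX hl k hs hst, hg.iterate_mean_eq hα hX' hl' k hs hst,
      intervalIntegral.integral_sub]
    · ring
    · exact intervalIntegrable_of_bound ((hf.iterate hα (k + 1)).measurable_mean hX)
        (abs_mean_le (hf.iterate hα (k + 1)).bounded) _ _
    · exact intervalIntegrable_of_bound ((hg.iterate hα (k + 1)).measurable_mean hX')
        (abs_mean_le (hg.iterate hα (k + 1)).bounded) _ _
  · intro k t _
    have h1 := abs_mean_le (P := P) (X := X) (hf.iterate hα k).bounded t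
    have h2 := abs_mean_le (P := P') (X := X') (hg.iterate hα k).bounded t
    refine (abs_sub _ _).trans ((add_le_add h1 h2).trans (le_of_eq ?_))
    ring
  · intro k
    rw [hX.mean_zero, hX'.mean_zero, iterate_generator_eq_of_reverse hα hf hg h, sub_self]

section Tree

variable {L : ℕ}

/-! ### Clusters -/

/-- The number of ones at positions `≥ p`. -/
def onesFrom (η : Fin L → Fin 2) (p : ℕ) : ℕ :=
  (Finset.univ.filter fun i : Fin L => η i = 1 ∧ p ≤ (i : ℕ)).card

/-- The number of zeros at positions `≥ p`. -/
def zerosFrom (η : Fin L → Fin 2) (p : ℕ) : ℕ :=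
  (Finset.univ.filter fun i : Fin L => η i = 0 ∧ p ≤ (i : ℕ)).card

theorem card_filter_from_eq (q : Fin L → Prop) [DecidablePred q] {p : ℕ} (hp : p < L) :
    (Finset.univ.filter fun i : Fin L => q i ∧ p ≤ (i : ℕ)).card =
      (Finset.univ.filter fun i : Fin L => q i ∧ p + 1 ≤ (i : ℕ)).card +
        if q ⟨p, hp⟩ then 1 else 0 := by
  split_ifs with h
  · rw [← Finset.card_insert_of_notMem (a := (⟨p, hp⟩ : Fin L))]
    · congr 1
      ext i
      simp only [Finset.mem_filter, Finset.mem_univ, true_and, Finset.mem_insert, Fin.ext_iff]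
      constructor
      · rintro ⟨h1, h2⟩
        rcases h2.eq_or_lt with h3 | h3
        · exact Or.inl h3.symm
        · exact Or.inr ⟨h1, h3⟩
      · rintro (h1 | ⟨h1, h2⟩)
        · have : i = ⟨p, hp⟩ := Fin.ext h1
          exact ⟨this ▸ h, h1.ge⟩
        · exact ⟨h1, by omega⟩
    · simp
  · rw [add_zero]
    congr 1
    ext i
    simp only [Finset.mem_filter, Finset.mem_univ, true_and]
    refine and_congr_right fun h1 => ?_
    have : (i : ℕ) ≠ p := by
      rintro h2
      exact h ((Fin.ext h2 : i = ⟨p, hp⟩) ▸ h1)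
    omega

theorem fin_two_eq_one_iff (a : Fin 2) : a = 1 ↔ ¬a = 0 := by omega

theorem onesFrom_of_one {η : Fin L → Fin 2} {p : ℕ} (hp : p < L) (h : η ⟨p, hp⟩ = 1) :
    onesFrom η p = onesFrom η (p + 1) + 1 := by
  rw [onesFrom, card_filter_from_eq (fun i => η i = 1) hp, if_pos h, onesFrom]

theorem onesFrom_of_zero {η : Fin L → Fin 2} {p : ℕ} (hp : p < L) (h : η ⟨p, hp⟩ = 0) :
    onesFrom η p = onesFrom η (p + 1) := by
  rw [onesFrom, card_filter_from_eq (fun i => η i = 1) hp, if_neg (by simp [h]), add_zero,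
    onesFrom]

theorem zerosFrom_of_one {η : Fin L → Fin 2} {p : ℕ} (hp : p < L) (h : η ⟨p, hp⟩ = 1) :
    zerosFrom η p = zerosFrom η (p + 1) := by
  rw [zerosFrom, card_filter_from_eq (fun i => η i = 0) hp, if_neg (by simp [h]), add_zero,
    zerosFrom]

theorem zerosFrom_of_zero {η : Fin L → Fin 2} {p : ℕ} (hp : p < L) (h : η ⟨p, hp⟩ = 0) :
    zerosFrom η p = zerosFrom η (p + 1) + 1 := by
  rw [zerosFrom, card_filter_from_eq (fun i => η i = 0) hp, if_pos h, zerosFrom]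

theorem onesFrom_length (η : Fin L → Fin 2) : onesFrom η L = 0 := by
  rw [onesFrom, Finset.card_eq_zero, Finset.filter_eq_empty_iff]
  rintro i - ⟨-, h⟩
  omega

theorem zerosFrom_length (η : Fin L → Fin 2) : zerosFrom η L = 0 := by
  rw [zerosFrom, Finset.card_eq_zero, Finset.filter_eq_empty_iff]
  rintro i - ⟨-, h⟩
  omega

theorem zerosFrom_antitone (η : Fin L → Fin 2) : Antitone (zerosFrom η) := fun _ _ h =>
  Finset.card_le_card (Finset.monotone_filter_right _ fun _ _ hi => ⟨hi.1, h.trans hi.2⟩)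

theorem clusterIndex_mono (η : Fin L → Fin 2) : Monotone (clusterIndex η) := fun _ _ h =>
  Finset.card_le_card (Finset.monotone_filter_right _ fun _ _ hk => le_trans hk h)

theorem clusterIndex_le (η : Fin L → Fin 2) (i : Fin L) : clusterIndex η i ≤ numClusters η :=
  Finset.card_filter_le _ _

theorem exists_clusterStart {η : Fin L → Fin 2} {q : Fin L} (hq : η q = 1) :
    ∃ r ∈ clusterStarts η, r ≤ q ∧ ∀ k, r ≤ k → k ≤ q → η k = 1 := by
  obtain ⟨q, hqL⟩ := q
  induction q with
  | zero =>
    refine ⟨⟨0, hqL⟩, ?_, le_rfl, fun k h1 h2 => (le_antisymm h1 h2) ▸ hq⟩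
    simp only [clusterStarts, Finset.mem_filter, Finset.mem_univ, true_and]
    exact ⟨hq, fun j hj => by simp at hj⟩
  | succ q ih =>
    by_cases h : η ⟨q, by omega⟩ = 1
    · obtain ⟨r, hr, hrq, hk⟩ := ih (by omega) h
      refine ⟨r, hr, hrq.trans (Fin.mk_le_mk.2 (by omega)), fun k h1 h2 => ?_⟩
      rcases h2.eq_or_lt with rfl | h3
      · exact hq
      · exact hk k h1 (Fin.mk_le_mk.2 (Nat.lt_succ_iff.1 h3))
    · refine ⟨⟨q + 1, hqL⟩, ?_, le_rfl, fun k h1 h2 => (le_antisymm h1 h2) ▸ hq⟩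
      simp only [clusterStarts, Finset.mem_filter, Finset.mem_univ, true_and]
      refine ⟨hq, fun j hj => ?_⟩
      have : j = ⟨q, by omega⟩ := Fin.ext (by simpa using hj)
      rw [this]
      rw [fin_two_eq_one_iff, not_not] at h
      exact h

theorem one_le_clusterIndex {η : Fin L → Fin 2} {q : Fin L} (hq : η q = 1) :
    1 ≤ clusterIndex η q := by
  obtain ⟨r, hr, hrq, -⟩ := exists_clusterStart hq
  exact Finset.card_pos.2 ⟨r, Finset.mem_filter.2 ⟨hr, hrq⟩⟩

theorem clusterIndex_lt {η : Fin L → Fin 2} {p q : Fin L} (hp : η p = 0) (hq : η q = 1)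
    (hpq : p ≤ q) : clusterIndex η p < clusterIndex η q := by
  obtain ⟨r, hr, hrq, hk⟩ := exists_clusterStart hq
  refine Finset.card_lt_card ⟨Finset.monotone_filter_right _ fun _ _ hk => le_trans hk hpq, ?_⟩
  intro hsub
  have h1 := (Finset.mem_filter.1 (hsub (Finset.mem_filter.2 ⟨hr, hrq⟩))).2
  have h2 := hk p h1 hpq
  rw [hp] at h2
  exact absurd h2 (by decide)

theorem sum_card_clusterIndex (η : Fin L → Fin 2) (a : Fin 2) (i : ℕ) :
    ∑ j ∈ Finset.Icc i (numClusters η),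
        (Finset.univ.filter fun k => η k = a ∧ clusterIndex η k = j).card =
      (Finset.univ.filter fun k => η k = a ∧ i ≤ clusterIndex η k).card := by
  rw [Finset.card_eq_sum_card_fiberwise (f := clusterIndex η) (t := Finset.Icc i (numClusters η))]
  · refine Finset.sum_congr rfl fun j hj => ?_
    rw [Finset.filter_filter]
    congr 1
    ext k
    simp only [Finset.mem_filter, Finset.mem_univ, true_and]
    have := (Finset.mem_Icc.1 hj).1
    constructor
    · rintro ⟨h1, h2⟩
      exact ⟨⟨h1, by omega⟩, h2⟩
    · rintro ⟨⟨h1, -⟩, h2⟩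
      exact ⟨h1, h2⟩
  · intro k hk
    simp only [Finset.coe_filter, Finset.mem_univ, true_and] at hk
    exact Finset.mem_coe.2 (Finset.mem_Icc.2 ⟨hk.2, clusterIndex_le η k⟩)

theorem Psi_eq_card (η : Fin L → Fin 2) (i : ℕ) :
    Psi η i = (Finset.univ.filter fun k => η k = 1 ∧ i ≤ clusterIndex η k).card :=
  sum_card_clusterIndex η 1 i

theorem Phi_eq_card (η : Fin L → Fin 2) (i : ℕ) :
    Phi η i = (Finset.univ.filter fun k => η k = 0 ∧ i ≤ clusterIndex η k).card :=
  sum_card_clusterIndex η 0 i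

theorem Psi_antitone (η : Fin L → Fin 2) : Antitone (Psi η) := by
  intro i j h
  rw [Psi_eq_card, Psi_eq_card]
  exact Finset.card_le_card (Finset.monotone_filter_right _ fun _ _ hi => ⟨hi.1, h.trans hi.2⟩)

theorem Phi_antitone (η : Fin L → Fin 2) : Antitone (Phi η) := by
  intro i j h
  rw [Phi_eq_card, Phi_eq_card]
  exact Finset.card_le_card (Finset.monotone_filter_right _ fun _ _ hi => ⟨hi.1, h.trans hi.2⟩)

theorem Psi_one (η : Fin L → Fin 2) : Psi η 1 = onesFrom η 0 := by
  rw [Psi_eq_card, onesFrom]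
  congr 1
  ext k
  simp only [Finset.mem_filter, Finset.mem_univ, true_and, Nat.zero_le, and_true]
  exact ⟨fun h => h.1, fun h => ⟨h, one_le_clusterIndex h⟩⟩

theorem Phi_zero (η : Fin L → Fin 2) : Phi η 0 = zerosFrom η 0 := by
  rw [Phi_eq_card, zerosFrom]
  simp only [Nat.zero_le]

/-- A zero separates clusters, so the ones to its right are exactly those of the later clusters. -/
theorem Psi_succ_clusterIndex {η : Fin L → Fin 2} {p : Fin L} (hp : η p = 0) :
    Psi η (clusterIndex η p + 1) = onesFrom η p := by
  rw [Psi_eq_card, onesFrom]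
  congr 1
  ext q
  simp only [Finset.mem_filter, Finset.mem_univ, true_and]
  refine and_congr_right fun hq => ?_
  constructor
  · intro h
    by_contra h'
    have := clusterIndex_mono η (le_of_lt (not_le.1 h') : q ≤ p)
    omega
  · intro h
    exact clusterIndex_lt hp hq h

theorem Phi_succ_clusterIndex_lt {η : Fin L → Fin 2} {p : Fin L} (hp : η p = 0) :
    Phi η (clusterIndex η p + 1) < zerosFrom η p := by
  rw [zerosFrom_of_zero p.2 hp, Nat.lt_succ_iff, Phi_eq_card]
  refine Finset.card_le_card (Finset.monotone_filter_right _ fun q _ hq => ⟨hq.1, ?_⟩)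
  by_contra h'
  have := clusterIndex_mono η (Nat.lt_succ_iff.1 (not_le.1 h') : q ≤ p)
  omega

theorem zerosFrom_le_Phi_clusterIndex {η : Fin L → Fin 2} (p : Fin L) :
    zerosFrom η p ≤ Phi η (clusterIndex η p) := by
  rw [Phi_eq_card]
  exact Finset.card_le_card (Finset.monotone_filter_right _ fun q _ hq =>
    ⟨hq.1, clusterIndex_mono η hq.2⟩)

/-- The intervals `(Φ_i, Φ_{i-1}]` are disjoint, and the row of the zero at `p` lies in the one with
`i = clusterIndex η p + 1`. So the only one-child node of this row is the one where no ones remain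
in front of that zero. -/
theorem oneChild_iff {η : Fin L → Fin 2} {p : Fin L} (hp : η p = 0) (x : ℕ) :
    OneChild η x (zerosFrom η p) ↔ x = onesFrom η p := by
  rw [← Psi_succ_clusterIndex hp]
  have h1 := Phi_succ_clusterIndex_lt hp
  have h2 := zerosFrom_le_Phi_clusterIndex (η := η) p
  constructor
  · rintro ⟨i, hi, -, rfl, h3, h4⟩
    have h5 : i ≤ clusterIndex η p + 1 := by
      by_contra h
      have := Phi_antitone η (by omega : clusterIndex η p + 1 ≤ i - 1)
      omega
    have h6 : clusterIndex η p + 1 ≤ i := by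
      by_contra h
      have := Phi_antitone η (by omega : i ≤ clusterIndex η p)
      omega
    rw [le_antisymm h5 h6]
  · intro h
    exact ⟨clusterIndex η p + 1, by omega, by have := clusterIndex_le η p; omega, h, h1, h2⟩

theorem twoChildren_iff_exists {η : Fin L → Fin 2} {x y : ℕ} : TwoChildren η x y ↔
    ∃ i, 1 ≤ i ∧ i ≤ numClusters η ∧ (x = Psi η i ∨ Psi η (i + 1) < x ∧ x < Psi η i) ∧
      1 ≤ y ∧ y ≤ Phi η i := by
  constructor
  · rintro (⟨i, h1, h2, h3, h4⟩ | ⟨i, h1, h2, h3, h4, h5⟩)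
    · exact ⟨i, h1, h2, Or.inl h3, h4⟩
    · exact ⟨i, h1, h2, Or.inr ⟨h3, h4⟩, h5⟩
  · rintro ⟨i, h1, h2, h3 | ⟨h3, h4⟩, h5⟩
    · exact Or.inl ⟨i, h1, h2, h3, h5⟩
    · exact Or.inr ⟨i, h1, h2, h3, h4, h5⟩

/-- No cluster is empty: the `i`-th element of `clusterStarts η` has cluster index `i`. -/
theorem Psi_succ_lt {η : Fin L → Fin 2} {i : ℕ} (h1 : 1 ≤ i) (h2 : i ≤ numClusters η) :
    Psi η (i + 1) < Psi η i := by
  have key : ∃ q, η q = 1 ∧ clusterIndex η q = i := by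
    set s := clusterStarts η with hs
    have hcard : s.card = numClusters η := rfl
    set r := s.orderEmbOfFin hcard ⟨i - 1, by omega⟩ with hr
    have hrs : r ∈ s := s.orderEmbOfFin_mem hcard _
    refine ⟨r, (Finset.mem_filter.1 hrs).2.1, ?_⟩
    have : s.filter (· ≤ r) = (Finset.univ.filter fun k : Fin (numClusters η) =>
        (k : ℕ) ≤ i - 1).map (s.orderEmbOfFin hcard).toEmbedding := by
      ext q
      simp only [Finset.mem_filter, Finset.mem_map, Finset.mem_univ, true_and]
      constructor
      · rintro ⟨hq, hqr⟩
        have : q ∈ Set.range (s.orderEmbOfFin hcard) := by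
          rw [Finset.range_orderEmbOfFin]; exact hq
        obtain ⟨k, rfl⟩ := this
        refine ⟨k, ?_, rfl⟩
        exact (s.orderEmbOfFin hcard).le_iff_le.1 hqr
      · rintro ⟨k, hk, rfl⟩
        exact ⟨s.orderEmbOfFin_mem hcard _, (s.orderEmbOfFin hcard).le_iff_le.2 hk⟩
    rw [clusterIndex, this, Finset.card_map]
    have h3 : (Finset.univ.filter fun k : Fin (numClusters η) => (k : ℕ) ≤ i - 1) =
        Finset.Iic ⟨i - 1, by omega⟩ := by
      ext k
      simp [Fin.le_def]
    rw [h3, Fin.card_Iic]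
    simp only
    omega
  obtain ⟨q, hq, hqi⟩ := key
  rw [Psi_eq_card, Psi_eq_card]
  refine Finset.card_lt_card ⟨Finset.monotone_filter_right _ fun _ _ hi => ⟨hi.1, by omega⟩, ?_⟩
  intro hsub
  have := (Finset.mem_filter.1 (hsub (Finset.mem_filter.2 ⟨Finset.mem_univ q, hq, hqi.ge⟩))).2.2
  omega

/-- The intervals `(Ψ_{i+1}, Ψ_i]` for the clusters to the left of the zero tile the range from
`onesFrom η p` to `Ψ_1`, and the bound `y ≤ Φ_i` is automatic for these clusters. -/
theorem twoChildren_iff {η : Fin L → Fin 2} {p : Fin L} (hp : η p = 0) (x : ℕ) :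
    TwoChildren η x (zerosFrom η p) ↔ onesFrom η p < x ∧ x ≤ Psi η 1 := by
  rw [← Psi_succ_clusterIndex hp, twoChildren_iff_exists]
  have h1 := Phi_succ_clusterIndex_lt hp
  have h2 := zerosFrom_le_Phi_clusterIndex (η := η) p
  constructor
  · rintro ⟨i, hi, hiA, h3, h4, h5⟩
    have h6 : i ≤ clusterIndex η p := by
      by_contra h
      have := Phi_antitone η (by omega : clusterIndex η p + 1 ≤ i)
      omega
    have h7 := Psi_succ_lt hi hiA
    have h8 := Psi_antitone η (by omega : i + 1 ≤ clusterIndex η p + 1)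
    have h9 := Psi_antitone η hi
    omega
  · rintro ⟨h3, h4⟩
    set i := Nat.findGreatest (fun i => x ≤ Psi η i) (clusterIndex η p) with hi
    have hc : 1 ≤ clusterIndex η p := by
      by_contra h
      have : clusterIndex η p = 0 := by omega
      rw [this, zero_add] at h3
      omega
    have h5 : x ≤ Psi η i := Nat.findGreatest_spec (P := fun i => x ≤ Psi η i) hc h4
    have h6 : 1 ≤ i := Nat.le_findGreatest hc h4
    have h7 : i ≤ clusterIndex η p := Nat.findGreatest_le _
    have h8 : Psi η (i + 1) < x := by
      rcases h7.eq_or_lt with h | h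
      · rw [h]; exact h3
      · have := Nat.findGreatest_is_greatest (P := fun i => x ≤ Psi η i) (Nat.lt_succ_self i) h
        exact not_le.1 this
    have h9 := Phi_antitone η h7
    have := clusterIndex_le η p
    exact ⟨i, h6, by omega, by omega, by omega, by omega⟩

/-- The position of the `y`-th zero from the right, and `L` for `y = 0`. -/
def zeroPos (η : Fin L → Fin 2) (y : ℕ) : ℕ := Nat.findGreatest (fun p => y ≤ zerosFrom η p) L

theorem zeroPos_zero (η : Fin L → Fin 2) : zeroPos η 0 = L :=
  Nat.findGreatest_eq (Nat.zero_le _)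

theorem zeroPos_spec {η : Fin L → Fin 2} {y : ℕ} (hy : 1 ≤ y) (hy' : y ≤ Phi η 0) :
    ∃ hp : zeroPos η y < L, η ⟨zeroPos η y, hp⟩ = 0 ∧ zerosFrom η (zeroPos η y) = y := by
  rw [Phi_zero] at hy'
  have h1 : y ≤ zerosFrom η (zeroPos η y) :=
    Nat.findGreatest_spec (P := fun p => y ≤ zerosFrom η p) (Nat.zero_le L) hy'
  have h2 : zeroPos η y ≤ L := Nat.findGreatest_le _
  have h3 : zeroPos η y < L := by
    refine lt_of_le_of_ne h2 fun h => ?_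
    rw [h, zerosFrom_length] at h1
    omega
  have h4 : zerosFrom η (zeroPos η y + 1) < y :=
    not_le.1 (Nat.findGreatest_is_greatest (P := fun p => y ≤ zerosFrom η p)
      (Nat.lt_succ_self _) h3)
  have h5 : η ⟨zeroPos η y, h3⟩ = 0 := by
    by_contra h
    rw [zerosFrom_of_one h3 ((fin_two_eq_one_iff _).2 h)] at h1
    omega
  refine ⟨h3, h5, ?_⟩
  rw [zerosFrom_of_zero h3 h5] at h1 ⊢
  omega

theorem zeroPos_zerosFrom {η : Fin L → Fin 2} {p : ℕ} (hp : p < L) (h : η ⟨p, hp⟩ = 0) :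
    zeroPos η (zerosFrom η p) = p := by
  refine le_antisymm ?_ (Nat.le_findGreatest hp.le le_rfl)
  by_contra h'
  have h1 : zerosFrom η p ≤ zerosFrom η (zeroPos η (zerosFrom η p)) :=
    Nat.findGreatest_spec (P := fun q => zerosFrom η p ≤ zerosFrom η q) hp.le le_rfl
  have h2 := zerosFrom_antitone η (by omega : p + 1 ≤ zeroPos η (zerosFrom η p))
  rw [zerosFrom_of_zero hp h] at h1 h2
  omega

/-! ### Normal ordering of the matrix product -/

section Ansatz

variable {α : ℝ} {V : Type} [AddCommGroup V] [PartialOrder V] [IsOrderedAddMonoid V] [Module ℝ V]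
  [IsOrderedModule ℝ V]

namespace MatrixAnsatz

/-- The product of the letters of `η` from position `p` on, applied to the column vector. -/
def suffix (R : MatrixAnsatz α V) (η : Fin L → Fin 2) (p : ℕ) : V :=
  ((List.ofFn fun i => if η i = 1 then R.D else R.E).drop p).prod R.v

theorem suffix_length (R : MatrixAnsatz α V) (η : Fin L → Fin 2) : R.suffix η L = R.v := by
  rw [suffix, List.drop_eq_nil_of_le (by simp), List.prod_nil, Module.End.one_apply]

theorem suffix_eq (R : MatrixAnsatz α V) (η : Fin L → Fin 2) {p : ℕ} (hp : p < L) :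
    R.suffix η p = (if η ⟨p, hp⟩ = 1 then R.D else R.E) (R.suffix η (p + 1)) := by
  rw [suffix, List.drop_eq_getElem_cons (by simpa using hp), List.prod_cons, Module.End.mul_apply,
    List.getElem_ofFn]
  rfl

theorem bracket_eq (R : MatrixAnsatz α V) (η : Fin L → Fin 2) :
    R.bracket η = R.w (R.suffix η 0) := by
  rw [bracket, suffix, List.drop_zero]

theorem D_E_apply (R : MatrixAnsatz α V) (u : V) :
    R.D (R.E u) = (1 / 4 : ℝ) • (R.D u + R.E u) := by
  have := LinearMap.congr_fun R.D_mul_E u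
  simpa using this

/-- From `p` up to the next zero (or the end of the word) there are only ones, each contributing a
factor `D`. -/
theorem suffix_eq_pow (R : MatrixAnsatz α V) (η : Fin L → Fin 2) {p : ℕ} (hp : p ≤ L) :
    onesFrom η (zeroPos η (zerosFrom η p)) ≤ onesFrom η p ∧
      R.suffix η p = (R.D ^ (onesFrom η p - onesFrom η (zeroPos η (zerosFrom η p))))
        (R.suffix η (zeroPos η (zerosFrom η p))) := by
  induction hp using Nat.decreasingInduction with
  | self => simp [zerosFrom_length, zeroPos_zero]
  | of_succ p hp ih =>
    by_cases h : η ⟨p, hp⟩ = 0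
    · simp [zeroPos_zerosFrom hp h]
    · have h := (fin_two_eq_one_iff _).2 h
      rw [zerosFrom_of_one hp h, onesFrom_of_one hp h]
      refine ⟨by omega, ?_⟩
      rw [R.suffix_eq η hp, if_pos h, Nat.sub_add_comm ih.1, pow_succ', Module.End.mul_apply,
        ← ih.2]

/-- The value of a node of the DEHP-tree. -/
def nodeValue (R : MatrixAnsatz α V) (η : Fin L → Fin 2) (x y : ℕ) : ℝ :=
  if onesFrom η (zeroPos η y) ≤ x then
    R.w ((R.D ^ (x - onesFrom η (zeroPos η y))) (R.suffix η (zeroPos η y))) else 0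

theorem nodeValue_zero (R : MatrixAnsatz α V) (η : Fin L → Fin 2) (x : ℕ) :
    R.nodeValue η x 0 = R.w ((R.D ^ x) R.v) := by
  simp [nodeValue, zeroPos_zero, onesFrom_length, suffix_length]

/-- The defining position in `nodeValue` may be replaced by any `p` with the same zeros to its
right. This is needed just after a zero, where a run of ones may follow. -/
theorem nodeValue_zerosFrom (R : MatrixAnsatz α V) (η : Fin L → Fin 2) {p : ℕ} (hp : p ≤ L)
    {x : ℕ} (hx : onesFrom η p ≤ x) : R.nodeValue η x (zerosFrom η p) =
      R.w ((R.D ^ (x - onesFrom η p)) (R.suffix η p)) := by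
  obtain ⟨h1, h2⟩ := R.suffix_eq_pow η hp
  rw [nodeValue, if_pos (h1.trans hx), h2, ← Module.End.mul_apply, ← pow_add]
  congr 4
  omega

theorem nodeValue_root (R : MatrixAnsatz α V) (η : Fin L → Fin 2) :
    R.nodeValue η (Psi η 1) (Phi η 0) = R.bracket η := by
  rw [Psi_one, Phi_zero, R.nodeValue_zerosFrom η (Nat.zero_le L) le_rfl, bracket_eq]
  simp

-- A node stands for the word `D ^ k` followed by the tail of `η` from its `y`-th zero from the
-- right. For `k = 0` the leading `E` is absorbed by `α wE = c w`; otherwise `DE = c(D + E)` splits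
-- the word into those of the two children. Nodes with too few ones have value zero.
open Classical in
theorem nodeValue_eq (R : MatrixAnsatz α V) (hα : 0 < α) (η : Fin L → Fin 2) {x y : ℕ}
    (hx : x ≤ Psi η 1) (hy : y + 1 ≤ Phi η 0) :
    R.nodeValue η x (y + 1) =
      ((if OneChild η x (y + 1) then 1 / 4 / α else 0) +
          if TwoChildren η x (y + 1) then 1 / 4 else 0) * R.nodeValue η x y +
        (if TwoChildren η x (y + 1) then 1 / 4 else 0) * R.nodeValue η (x - 1) (y + 1) := by
  obtain ⟨p, hpy, hp, h0, hz⟩ : ∃ p, zeroPos η (y + 1) = p ∧ ∃ hp : p < L, η ⟨p, hp⟩ = 0 ∧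
      zerosFrom η p = y + 1 := ⟨_, rfl, zeroPos_spec (by omega) hy⟩
  have hz' : zerosFrom η (p + 1) = y := by
    have := zerosFrom_of_zero hp h0
    omega
  have ho := onesFrom_of_zero hp h0
  have h1 : OneChild η x (zerosFrom η p) ↔ x = onesFrom η p := oneChild_iff h0 x
  have h2 : TwoChildren η x (zerosFrom η p) ↔ onesFrom η p < x ∧ x ≤ Psi η 1 :=
    twoChildren_iff h0 x
  rw [hz] at h1 h2
  have hS : R.suffix η p = R.E (R.suffix η (p + 1)) := by
    rw [R.suffix_eq η hp, if_neg (by simp [h0])]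
  rcases lt_trichotomy x (onesFrom η p) with h | h | h
  · rw [if_neg (mt h1.1 (by omega)), if_neg (mt h2.1 (by omega)), nodeValue, hpy, if_neg (by omega)]
    ring
  · rw [if_pos (h1.2 h), if_neg (mt h2.1 (by omega)), ← hz, R.nodeValue_zerosFrom η hp.le h.ge, hz, ← hz',
      R.nodeValue_zerosFrom η (p := p + 1) hp (by omega), ← ho, h, Nat.sub_self, pow_zero, hS,
      Module.End.one_apply, Module.End.one_apply]
    have := R.w_E (R.suffix η (p + 1))
    field_simp
    linarith
  · rw [if_neg (mt h1.1 (by omega)), if_pos (h2.2 ⟨h, hx⟩), ← hz, R.nodeValue_zerosFrom η hp.le h.le,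
      R.nodeValue_zerosFrom η hp.le (by omega), ← hz',
      R.nodeValue_zerosFrom η (p := p + 1) hp (by omega), ← ho, hS]
    obtain ⟨k, hk⟩ : ∃ k, x - onesFrom η p = k + 1 := ⟨x - onesFrom η p - 1, by omega⟩
    have hk' : x - 1 - onesFrom η p = k := by omega
    rw [hk, hk', pow_succ, Module.End.mul_apply, Module.End.mul_apply, R.D_E_apply, map_smul,
      map_add, map_smul, map_add, smul_eq_mul]
    ring

end MatrixAnsatz

end Ansatz

/-! ### Recursion for the partition function -/

/-- A path is trivial or has a last edge. -/
def treePathEquiv (η : Fin L → Fin 2) (x y : ℕ) : TreePath η x y ≃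
    (PLift (x = Psi η 1 ∧ y = Phi η 0) ⊕ TreePath η x (y + 1) × PLift (OneChild η x (y + 1))) ⊕
    (TreePath η x (y + 1) × PLift (TwoChildren η x (y + 1)) ⊕
      TreePath η (x + 1) y × PLift (TwoChildren η (x + 1) y)) where
  toFun
    | .root => .inl (.inl ⟨rfl, rfl⟩)
    | .only p h => .inl (.inr (p, ⟨h⟩))
    | .left p h => .inr (.inl (p, ⟨h⟩))
    | .right p h => .inr (.inr (p, ⟨h⟩))
  invFun
    | .inl (.inl h) => h.down.1.symm ▸ h.down.2.symm ▸ .root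
    | .inl (.inr (p, h)) => .only p h.down
    | .inr (.inl (p, h)) => .left p h.down
    | .inr (.inr (p, h)) => .right p h.down
  left_inv p := by cases p <;> rfl
  right_inv q := by
    rcases q with (⟨⟨h⟩⟩ | ⟨p, ⟨h⟩⟩) | (⟨p, ⟨h⟩⟩ | ⟨p, ⟨h⟩⟩)
    · obtain ⟨rfl, rfl⟩ := h
      rfl
    all_goals rfl

theorem TreePath.le {η : Fin L → Fin 2} {x y : ℕ} (p : TreePath η x y) :
    x ≤ Psi η 1 ∧ y ≤ Phi η 0 := by
  induction p with
  | root => exact ⟨le_rfl, le_rfl⟩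
  | only p h ih => omega
  | left p h ih => omega
  | right p h ih => omega

instance finite_treePath (η : Fin L → Fin 2) (x y : ℕ) : Finite (TreePath η x y) := by
  have key : ∀ n x y, Psi η 1 + Phi η 0 + 1 ≤ x + y + n → Finite (TreePath η x y) := by
    intro n
    induction n with
    | zero =>
      intro x y h
      have : IsEmpty (TreePath η x y) := ⟨fun p => by have := p.le; omega⟩
      infer_instance
    | succ n ih =>
      intro x y h
      have := ih x (y + 1) (by omega)
      have := ih (x + 1) y (by omega)
      exact Finite.of_equiv _ (treePathEquiv η x y).symm
  exact key (Psi η 1 + Phi η 0 + 1) x y (by omega)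

theorem partitionFunction_eq_zero (α : ℝ) {η : Fin L → Fin 2} {x y : ℕ}
    (h : Psi η 1 < x ∨ Phi η 0 < y) : partitionFunction α η x y = 0 := by
  have : IsEmpty (TreePath η x y) := ⟨fun p => by have := p.le; omega⟩
  rw [partitionFunction, finsum_of_isEmpty]

open Classical in
theorem partitionFunction_eq (α : ℝ) (η : Fin L → Fin 2) (x y : ℕ) :
    partitionFunction α η x y = (if x = Psi η 1 ∧ y = Phi η 0 then 1 else 0) +
      partitionFunction α η x (y + 1) * ((if OneChild η x (y + 1) then 1 / 4 / α else 0) +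
        if TwoChildren η x (y + 1) then 1 / 4 else 0) +
      partitionFunction α η (x + 1) y * (if TwoChildren η (x + 1) y then 1 / 4 else 0) := by
  have : ∀ x y, Fintype (TreePath η x y) := fun x y => Fintype.ofFinite _
  have hw : ∀ p, (TreePath.weight α p : ℝ) = Sum.elim (Sum.elim (fun _ => 1)
      fun q => q.1.weight α * (1 / 4 / α)) (Sum.elim (fun q => q.1.weight α * (1 / 4))
      fun q => q.1.weight α * (1 / 4)) (treePathEquiv η x y p) := by
    intro p
    cases p <;> rfl
  have hP : ∀ (p : Prop) [Decidable p] (c : ℝ), ∑ _h : PLift p, c = if p then c else 0 := by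
    intro p _ c
    split_ifs with h
    · have : Unique (PLift p) := ⟨⟨⟨h⟩⟩, fun _ => rfl⟩
      simp
    · have : IsEmpty (PLift p) := ⟨fun q => h q.down⟩
      simp
  simp only [partitionFunction, finsum_eq_sum_of_fintype]
  rw [Finset.sum_congr rfl fun p _ => hw p, (treePathEquiv η x y).sum_comp, Fintype.sum_sum_type,
    Fintype.sum_sum_type, Fintype.sum_sum_type]
  simp only [Sum.elim_inl, Sum.elim_inr, Fintype.sum_prod_type, hP]
  by_cases h1 : OneChild η x (y + 1) <;> by_cases h2 : TwoChildren η x (y + 1) <;>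
    by_cases h3 : TwoChildren η (x + 1) y <;> simp only [h1, h2, h3, if_true, if_false] <;>
    simp only [Finset.sum_const_zero, ← Finset.sum_mul] <;> ring

/-- The matrix product is the sum over the leaves of the DEHP-tree. -/
theorem bracket_eq_sum_partitionFunction {α : ℝ} (hα : 0 < α) {V : Type} [AddCommGroup V]
    [PartialOrder V] [IsOrderedAddMonoid V] [Module ℝ V] [IsOrderedModule ℝ V]
    (R : MatrixAnsatz α V) (η : Fin L → Fin 2) :
    R.bracket η = ∑ k ∈ Finset.range (Psi η 1 + 1),
      partitionFunction α η k 0 * R.w ((R.D ^ k) R.v) := by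
  classical
  set X := Psi η 1 with hX
  set Y := Phi η 0 with hY
  set F := partitionFunction α η
  set g := R.nodeValue η
  set q : ℕ → ℕ → ℝ := fun x y =>
    (if OneChild η x y then 1 / 4 / α else 0) + if TwoChildren η x y then 1 / 4 else 0
  set q' : ℕ → ℕ → ℝ := fun x y => if TwoChildren η x y then 1 / 4 else 0
  -- There is no branching in row `0` or column `0`, so the truncated `x - 1` below never matters.
  have hq' : ∀ x, q' x 0 = 0 := fun x => if_neg fun h => by
    obtain ⟨i, -, -, -, h, -⟩ := twoChildren_iff_exists.1 h
    omega
  have hq'' : ∀ y, q' 0 y = 0 := fun y => if_neg fun h => by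
    obtain ⟨i, h1, h2, h3, -, -⟩ := twoChildren_iff_exists.1 h
    have := Psi_succ_lt h1 h2
    omega
  -- Pair path weights with node values over all nodes. Expanding `F` by the last edge of a path and
  -- `g` by the edges leaving a node produces the same edge terms; after cancellation the root value
  -- equals the sum over the bottom row.
  have h1 : ∑ x ∈ Finset.range (X + 1), ∑ y ∈ Finset.range (Y + 1), F x y * g x y =
      g X Y + ∑ x ∈ Finset.range (X + 1), ∑ y ∈ Finset.range (Y + 1),
        F x (y + 1) * q x (y + 1) * g x y + ∑ x ∈ Finset.range (X + 1),
        ∑ y ∈ Finset.range (Y + 1), F (x + 1) y * q' (x + 1) y * g x y := by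
    have h2 : g X Y = ∑ x ∈ Finset.range (X + 1), ∑ y ∈ Finset.range (Y + 1),
        (if x = X ∧ y = Y then 1 else 0) * g x y := by
      rw [Finset.sum_eq_single X, Finset.sum_eq_single Y]
      · simp
      · intro y _ hy
        simp [hy]
      · simp
      · intro x _ hx
        simp [hx]
      · simp
    rw [h2, ← Finset.sum_add_distrib, ← Finset.sum_add_distrib]
    refine Finset.sum_congr rfl fun x _ => ?_
    rw [← Finset.sum_add_distrib, ← Finset.sum_add_distrib]
    refine Finset.sum_congr rfl fun y _ => ?_
    have h3 : F x y = _ := partitionFunction_eq α η x y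
    rw [h3, add_mul, add_mul]
  have h2 : ∀ x, ∑ y ∈ Finset.range (Y + 1), F x (y + 1) * q x (y + 1) * g x y =
      ∑ y ∈ Finset.range Y, F x (y + 1) * q x (y + 1) * g x y := by
    intro x
    have h3 : F x (Y + 1) = 0 := partitionFunction_eq_zero α (Or.inr (Nat.lt_succ_self _))
    rw [Finset.sum_range_succ, h3, zero_mul, zero_mul, add_zero]
  have h3 : ∀ y, ∑ x ∈ Finset.range (X + 1), F (x + 1) y * q' (x + 1) y * g x y =
      ∑ x ∈ Finset.range (X + 1), F x y * q' x y * g (x - 1) y := by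
    intro y
    have h4 : F (X + 1) y = 0 := partitionFunction_eq_zero α (Or.inl (Nat.lt_succ_self _))
    rw [Finset.sum_range_succ, h4, Finset.sum_range_succ' _ X, hq'']
    simp
  have h4 : ∑ x ∈ Finset.range (X + 1), ∑ y ∈ Finset.range (Y + 1),
        F (x + 1) y * q' (x + 1) y * g x y = ∑ x ∈ Finset.range (X + 1),
        ∑ y ∈ Finset.range Y, F x (y + 1) * q' x (y + 1) * g (x - 1) (y + 1) := by
    rw [Finset.sum_comm, Finset.sum_congr rfl fun y _ => h3 y, Finset.sum_comm]
    refine Finset.sum_congr rfl fun x _ => ?_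
    rw [Finset.sum_range_succ', hq']
    simp
  simp only [h2, h4] at h1
  have h5 : ∀ x ∈ Finset.range (X + 1), ∑ y ∈ Finset.range (Y + 1), F x y * g x y =
      F x 0 * g x 0 + (∑ y ∈ Finset.range Y, F x (y + 1) * q x (y + 1) * g x y +
        ∑ y ∈ Finset.range Y, F x (y + 1) * q' x (y + 1) * g (x - 1) (y + 1)) := by
    intro x hx
    rw [Finset.sum_range_succ', add_comm, ← Finset.sum_add_distrib]
    congr 1
    refine Finset.sum_congr rfl fun y hy => ?_
    rw [Finset.mem_range] at hx hy
    have h6 : g x (y + 1) = q x (y + 1) * g x y + q' x (y + 1) * g (x - 1) (y + 1) :=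
      R.nodeValue_eq hα η (by omega) (by omega)
    rw [h6]
    ring
  rw [Finset.sum_congr rfl h5, Finset.sum_add_distrib, Finset.sum_add_distrib] at h1
  have h6 : g X Y = R.bracket η := R.nodeValue_root η
  have h7 : ∀ k, g k 0 = R.w ((R.D ^ k) R.v) := R.nodeValue_zero η
  simp only [h7] at h1
  rw [← h6]
  linarith

theorem bidiagonalAnsatz_bracket {α : ℝ} (hα : 0 < α) (η : Fin L → Fin 2) :
    (bidiagonalAnsatz α hα).bracket η = treeFormula α η := by
  rw [bracket_eq_sum_partitionFunction hα, treeFormula]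
  refine Finset.sum_congr rfl fun k _ => ?_
  rw [bidiagonalAnsatz_w_D_pow_v]
  ring

end Tree

/-! ### Reduction to the step initial condition -/

theorem act_trunc {u : List ℕ} {m : ℕ} (hu : ∀ i ∈ u, i < m) (η : Config) :
    act Color.first u (trunc m η) = trunc m (act Color.first u η) := by
  induction u generalizing η with
  | nil => rfl
  | cons i u ih =>
    obtain ⟨hi, hu⟩ := List.forall_mem_cons.1 hu
    rw [act_cons, act_cons, hecke_trunc hi, ih hu]

theorem mean_eq_real {Ω : Type*} [MeasurableSpace Ω] {P : Measure Ω} {X : ℝ≥0 → Ω → Config}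
    {f : Config → ℝ} (hf : Measurable f) {p : Config → Prop} (h1 : ∀ η, p η → f η = 1)
    (h0 : ∀ η, ¬p η → f η = 0) {t : ℝ≥0} (hX : Measurable (X t)) :
    mean P X f t = P.real {ω | p (X t ω)} := by
  have hset : MeasurableSet {ω | p (X t ω)} := by
    have : {ω | p (X t ω)} = (fun ω => f (X t ω)) ⁻¹' {1} := by
      ext ω
      by_cases h : p (X t ω)
      · simp [h, h1 _ h]
      · simp [h, h0 _ h]
    rw [this]
    exact (hf.comp hX) (measurableSet_singleton 1)
  rw [← integral_indicator_one hset, mean]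
  simp only [Real.toNNReal_coe]
  congr 1
  funext ω
  by_cases h : p (X t ω)
  · rw [h1 _ h, Set.indicator_of_mem (show ω ∈ {ω | p (X t ω)} from h), Pi.one_apply]
  · rw [h0 _ h, Set.indicator_of_notMem (show ω ∉ {ω | p (X t ω)} from h)]

/-- The number of particles of class `c` has the law of the number of holes in `J` that the
reversed word leaves in the process with step initial condition. -/
theorem real_encard_eq_real_card {Ω Ω' : Type*} [MeasurableSpace Ω] [MeasurableSpace Ω']
    {P : Measure Ω} [IsProbabilityMeasure P] {P' : Measure Ω'} [IsProbabilityMeasure P'] {α : ℝ}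
    (hα : 0 < α) {η : Config} {X : ℝ≥0 → Ω → Config} {Y : ℝ≥0 → Ω' → Config}
    (hX : IsTASEP P α η X) (hY : IsTASEP P' α stepInit Y) {φ : ℕ → Color} (hφ : Monotone φ)
    (h0 : φ 0 = Color.first) {w : List ℕ} (hw : act Color.first w (φ ∘ Nat.succ) = η) {c : Color}
    (hc : c ≠ Color.hole) {l : ℕ} (hl : ∀ i, l ≤ i → η i ≠ c) {J : Finset ℕ}
    (hJ : ∀ d, φ d = c ↔ ∃ j ∈ J, d = j + 1) (s : ℕ) (t : ℝ≥0) :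
    P.real {ω | {i | X t ω i = c}.encard = s} =
      P'.real {ω | (J.filter fun j =>
        act Color.first w.reverse (Y t ω) j = Color.hole).card = s} := by
  classical
  set g : Config → ℝ := fun ζ =>
    if (J.filter fun j => act Color.first w.reverse ζ j = Color.hole).card = s then 1 else 0
  have hf := admissible_countIndicator hc s
  obtain ⟨m, hm⟩ : ∃ m, ∀ i ∈ w.reverse.toFinset ∪ J, i < m :=
    ⟨(w.reverse.toFinset ∪ J).sup id + 1, fun i hi =>
      Nat.lt_succ_of_le (Finset.le_sup (f := id) hi)⟩
  have hg : DependsOn g (Set.Iio m) := by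
    intro ζ ζ' h
    have h1 : trunc m ζ = trunc m ζ' := by
      funext i
      simp only [trunc]
      split_ifs with hi
      · exact h i hi
      · rfl
    have h2 : ∀ j ∈ J, act Color.first w.reverse ζ j = act Color.first w.reverse ζ' j := by
      intro j hj
      have hj' := hm j (Finset.mem_union_right _ hj)
      have hu : ∀ i ∈ w.reverse, i < m := fun i hi =>
        hm i (Finset.mem_union_left _ (List.mem_toFinset.2 hi))
      have h3 := congrFun (act_trunc hu ζ) j
      rw [h1, act_trunc hu ζ'] at h3
      simp only [trunc, if_pos hj'] at h3
      exact h3.symm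
    have h3 : (J.filter fun j => act Color.first w.reverse ζ j = Color.hole) =
        J.filter fun j => act Color.first w.reverse ζ' j = Color.hole :=
      Finset.filter_congr fun j hj => by rw [h2 j hj]
    simp only [g, h3]
  -- Since `g` is local any class will do; one absent from `stepInit` makes the hypothesis on the
  -- initial condition trivial.
  have hg' := admissible_of_dependsOn Color.second hg (K := 1) fun ζ => by
    simp only [g]
    split_ifs <;> simp
  have key := mean_eq_of_reverse hα hX hY hl (c' := Color.second) (l' := 0)
    (fun i _ => by simp [stepInit]) hf hg' ?_ t
  · rw [← mean_eq_real (p := fun η => {i | η i = c}.encard = s) hf.measurable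
      (fun _ h => if_pos h) (fun _ h => if_neg h) (hX.measurable t), key]
    exact mean_eq_real hg'.measurable (fun _ h => if_pos h) (fun _ h => if_neg h) (hY.measurable t)
  · intro u
    rw [← hw, ← act_append, countIndicator, encard_act_eq_card_reverse hφ h0 hJ,
      List.reverse_append, act_append]
    simp only [g, Nat.cast_inj]

/-! ### Words -/

/-- The number of ones among the first `M + N` letters. -/
def leftOnes (M N : ℕ) (η : Fin (2 * M + 2 * N + 1) → Fin 2) : ℕ :=
  ∑ i ∈ {i : Fin (2 * M + 2 * N + 1) | (i : ℕ) < M + N}, (η i : ℕ)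

/-- The number of ones among the last `M + N + 1` letters. -/
def rightOnes (M N : ℕ) (η : Fin (2 * M + 2 * N + 1) → Fin 2) : ℕ :=
  ∑ i ∈ {i : Fin (2 * M + 2 * N + 1) | M + N ≤ (i : ℕ)}, (η i : ℕ)

theorem mem_wordClass {M N m n : ℕ} {η : Fin (2 * M + 2 * N + 1) → Fin 2} :
    η ∈ wordClass M N m n ↔ leftOnes M N η = m ∧ rightOnes M N η = n := by
  simp [wordClass, leftOnes, rightOnes]

/-- The occupation variables of the first `2M + 2N + 1` sites. -/
def occupationWord (M N : ℕ) (ζ : ℕ → Fin 2) : Fin (2 * M + 2 * N + 1) → Fin 2 := fun i => ζ i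

theorem holes_add_sum (ζ : Config) (m n : ℕ) :
    holes ζ m n + ∑ j ∈ Finset.Ico m n, (occupation ζ j : ℕ) = n - m := by
  rw [holes, Finset.card_filter, ← Finset.sum_add_distrib, ← Nat.card_Ico,
    Finset.card_eq_sum_ones]
  refine Finset.sum_congr rfl fun j _ => ?_
  by_cases h : ζ j = Color.hole <;> simp [occupation, h]

theorem holes_left (M N : ℕ) (ζ : Config) :
    holes ζ 0 (M + N) + leftOnes M N (occupationWord M N (occupation ζ)) = M + N := by
  have h := holes_add_sum ζ 0 (M + N)
  rw [Nat.sub_zero] at h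
  refine Eq.trans ?_ h
  rw [leftOnes, Nat.add_left_cancel_iff]
  refine Finset.sum_nbij (M := ℕ) (fun i => (i : ℕ)) ?_ ?_ ?_ ?_
  · intro i hi
    simpa using hi
  · intro i _ j _ hij
    exact Fin.ext hij
  · intro j hj
    simp only [Finset.coe_Ico, Set.mem_Ico] at hj
    exact ⟨⟨j, by omega⟩, by simpa using hj.2, rfl⟩
  · intro i _
    rfl

theorem holes_right (M N : ℕ) (ζ : Config) :
    holes ζ (M + N) (2 * M + 2 * N + 1) + rightOnes M N (occupationWord M N (occupation ζ)) =
      M + N + 1 := by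
  have h := holes_add_sum ζ (M + N) (2 * M + 2 * N + 1)
  rw [show 2 * M + 2 * N + 1 - (M + N) = M + N + 1 by omega] at h
  refine Eq.trans ?_ h
  rw [rightOnes, Nat.add_left_cancel_iff]
  refine Finset.sum_nbij (fun i => (i : ℕ)) ?_ ?_ ?_ ?_
  · intro i hi
    have := i.2
    simp only [Finset.mem_filter, Finset.mem_univ, true_and] at hi
    simp only [Finset.mem_Ico]
    omega
  · intro i _ j _ hij
    exact Fin.ext hij
  · intro j hj
    simp only [Finset.coe_Ico, Set.mem_Ico] at hj
    exact ⟨⟨j, hj.2⟩, by simpa using hj.1, rfl⟩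
  · intro i _
    rfl

/-- The number of holes that the reversed word produces in the window, as a function of the
occupation variables. -/
def wordHoles (M N : ℕ) (η : Fin (2 * M + 2 * N + 1) → Fin 2) : ℕ :=
  (N - leftOnes M N η) + min (M + N + 1 - rightOnes M N η) (N + 1)

theorem windowHoles_eq (M N : ℕ) (ζ : Config) :
    windowHoles M N ζ = wordHoles M N (occupationWord M N (occupation ζ)) := by
  have h1 := holes_left M N ζ
  have h2 := holes_right M N ζ
  rw [windowHoles, wordHoles]
  omega

/-- Allows the bounds on `leftOnes` and `rightOnes` to be read off from the hole counts. -/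
theorem word_eq_occupationWord (M N : ℕ) (η : Fin (2 * M + 2 * N + 1) → Fin 2) :
    ∃ ζ : Config, occupationWord M N (occupation ζ) = η := by
  refine ⟨fun i => if h : i < 2 * M + 2 * N + 1 then
    (if η ⟨i, h⟩ = 0 then Color.hole else Color.first) else Color.hole, ?_⟩
  funext i
  by_cases h : η i = 0
  · simp [occupationWord, occupation, h]
  · have := i.2
    simp [occupationWord, occupation, (fin_two_eq_one_iff _).2 h]
    omega

theorem leftOnes_le (M N : ℕ) (η : Fin (2 * M + 2 * N + 1) → Fin 2) : leftOnes M N η ≤ M + N := by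
  obtain ⟨ζ, rfl⟩ := word_eq_occupationWord M N η
  have := holes_left M N ζ
  omega

theorem rightOnes_le (M N : ℕ) (η : Fin (2 * M + 2 * N + 1) → Fin 2) :
    rightOnes M N η ≤ M + N + 1 := by
  obtain ⟨ζ, rfl⟩ := word_eq_occupationWord M N η
  have := holes_right M N ζ
  omega

/-! ### Regrouping words by their block sums -/

theorem sum_wordClass {ι : Type*} (M N : ℕ) (I : Finset ι) (a b : ι → ℕ)
    (hinj : Set.InjOn (fun k => (a k, b k)) I) (T : (Fin (2 * M + 2 * N + 1) → Fin 2) → ℝ)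
    (p : (Fin (2 * M + 2 * N + 1) → Fin 2) → Prop) [DecidablePred p]
    (hp : ∀ η, p η ↔ ∃ k ∈ I, leftOnes M N η = a k ∧ rightOnes M N η = b k) :
    ∑ k ∈ I, ∑ η ∈ wordClass M N (a k) (b k), T η = ∑ η ∈ Finset.univ.filter p, T η := by
  classical
  rw [← Finset.sum_biUnion]
  · congr 1
    ext η
    simp only [Finset.mem_biUnion, mem_wordClass, Finset.mem_filter, Finset.mem_univ, true_and, hp]
  · intro k hk k' hk' hne
    rw [Function.onFun, Finset.disjoint_left]
    intro η h h'
    rw [mem_wordClass] at h h'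
    exact hne (hinj hk hk' (Prod.ext (h.1.symm.trans h'.1) (h.2.symm.trans h'.2)))

/-- With `m` and `n` ones in the two blocks, `N < (N - m) + min (M + N + 1 - n) (N + 1)` means `n ≤
M + N - m` if `m < N`, and `n ≤ M` if `m ≥ N`, where `N - m` truncates to zero. -/
theorem sum_filter_wordHoles_lt (M N : ℕ) (T : (Fin (2 * M + 2 * N + 1) → Fin 2) → ℝ) :
    ∑ η ∈ Finset.univ.filter (fun η => N < wordHoles M N η), T η =
      (∑ m ∈ Finset.range N, ∑ n ∈ Finset.Icc 0 (M + N - m), ∑ η ∈ wordClass M N m n, T η) +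
        ∑ m ∈ Finset.Icc N (M + N), ∑ n ∈ Finset.Icc 0 M, ∑ η ∈ wordClass M N m n, T η := by
  classical
  have e1 : ∀ (A : Finset ℕ) (B : ℕ → Finset ℕ),
      ∑ m ∈ A, ∑ n ∈ B m, ∑ η ∈ wordClass M N m n, T η =
        ∑ k ∈ A.sigma B, ∑ η ∈ wordClass M N k.1 k.2, T η :=
    fun A B => (Finset.sum_sigma A B fun k => ∑ η ∈ wordClass M N k.1 k.2, T η).symm
  rw [e1, e1, sum_wordClass M N _ (fun k : (_ : ℕ) × ℕ => k.1) (fun k => k.2) _ T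
      (fun η => leftOnes M N η < N ∧ rightOnes M N η ≤ M + N - leftOnes M N η),
    sum_wordClass M N _ (fun k : (_ : ℕ) × ℕ => k.1) (fun k => k.2) _ T
      (fun η => N ≤ leftOnes M N η ∧ rightOnes M N η ≤ M), ← Finset.sum_union]
  · congr 1
    ext η
    have h1 := leftOnes_le M N η
    have h2 := rightOnes_le M N η
    simp only [Finset.mem_filter, Finset.mem_univ, true_and, Finset.mem_union]
    rw [wordHoles]
    omega
  · rw [Finset.disjoint_left]
    intro η h h'
    simp only [Finset.mem_filter, Finset.mem_univ, true_and] at h h'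
    omega
  · intro η
    have h1 := leftOnes_le M N η
    constructor
    · rintro ⟨h2, h3⟩
      exact ⟨⟨leftOnes M N η, rightOnes M N η⟩, by simp; omega, rfl, rfl⟩
    · rintro ⟨⟨a, b⟩, h2, h3, h4⟩
      simp at h2 h3 h4
      omega
  · rintro ⟨a, b⟩ _ ⟨a', b'⟩ _ h
    simp only [Prod.mk.injEq] at h
    obtain ⟨rfl, rfl⟩ := h
    rfl
  · intro η
    constructor
    · rintro ⟨h2, h3⟩
      exact ⟨⟨leftOnes M N η, rightOnes M N η⟩, by simp; omega, rfl, rfl⟩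
    · rintro ⟨⟨a, b⟩, h2, h3, h4⟩
      simp at h2 h3 h4
      omega
  · rintro ⟨a, b⟩ _ ⟨a', b'⟩ _ h
    simp only [Prod.mk.injEq] at h
    obtain ⟨rfl, rfl⟩ := h
    rfl

/-- Since `s ≤ N`, the cap `N + 1` in `wordHoles` is not attained and the right block sum is
determined by the left one. The index `n` is the excess `N - leftOnes M N η` when positive; the
remaining words form the second sum. -/
theorem sum_filter_wordHoles_eq (M N : ℕ) {s : ℕ} (hs : s ≤ N)
    (T : (Fin (2 * M + 2 * N + 1) → Fin 2) → ℝ) :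
    ∑ η ∈ Finset.univ.filter (fun η => wordHoles M N η = s), T η =
      (∑ n ∈ Finset.Icc 1 s, ∑ η ∈ wordClass M N (N - n) (M + N + 1 - s + n), T η) +
        ∑ m ∈ Finset.Icc N (M + N), ∑ η ∈ wordClass M N m (M + N + 1 - s), T η := by
  classical
  rw [sum_wordClass M N _ (fun n => N - n) (fun n => M + N + 1 - s + n) _ T
      (fun η => leftOnes M N η < N ∧ wordHoles M N η = s),
    sum_wordClass M N _ (fun m => m) (fun _ => M + N + 1 - s) _ T
      (fun η => N ≤ leftOnes M N η ∧ wordHoles M N η = s), ← Finset.sum_union]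
  · congr 1
    ext η
    simp only [Finset.mem_filter, Finset.mem_univ, true_and, Finset.mem_union]
    omega
  · rw [Finset.disjoint_left]
    intro η h h'
    simp only [Finset.mem_filter, Finset.mem_univ, true_and] at h h'
    omega
  · intro η
    have h1 := leftOnes_le M N η
    have h2 := rightOnes_le M N η
    rw [wordHoles]
    constructor
    · rintro ⟨h3, h4⟩
      exact ⟨leftOnes M N η, by simp; omega, rfl, by omega⟩
    · rintro ⟨k, h3, h4, h5⟩
      rw [Finset.mem_Icc] at h3
      omega
  · intro a _ a' _ h
    exact (Prod.mk.inj h).1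
  · intro η
    have h1 := leftOnes_le M N η
    have h2 := rightOnes_le M N η
    rw [wordHoles]
    constructor
    · rintro ⟨h3, h4⟩
      exact ⟨N - leftOnes M N η, by simp; omega, by omega, by omega⟩
    · rintro ⟨k, h3, h4, h5⟩
      rw [Finset.mem_Icc] at h3
      omega
  · intro a _ a' _ h
    have := (Prod.mk.inj h).2
    omega

/-! ### The limit of the step process -/

theorem continuous_occupationWord (M N : ℕ) : Continuous (occupationWord M N) :=
  continuous_pi fun i => continuous_apply (i : ℕ)

/-- Events depending on finitely many occupation variables are clopen, so they have empty frontier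
and the portmanteau theorem applies. The limit measure is evaluated with `bidiagonalAnsatz`. -/
theorem tendsto_real_occupationWord {Ω : Type*} [MeasurableSpace Ω] {P : Measure Ω}
    [IsProbabilityMeasure P] {α : ℝ} (hα : 0 < α) {Y : ℝ≥0 → Ω → Config}
    (h : ConvergesToMatrixProduct P α Y) (M N : ℕ)
    (A : Finset (Fin (2 * M + 2 * N + 1) → Fin 2)) :
    Tendsto (fun t => P.real {ω | occupationWord M N (occupation (Y t ω)) ∈ A}) atTop
      (𝓝 (∑ η ∈ A, treeFormula α η)) := by
  obtain ⟨μ, hμ, hmat, hconv⟩ := h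
  set S : Set (ℕ → Fin 2) := occupationWord M N ⁻¹' (A : Set _)
  have hS : IsClopen S := (isClopen_discrete _).preimage (continuous_occupationWord M N)
  have h1 := hconv.tendsto
  have h2 := ProbabilityMeasure.tendsto_measure_of_null_frontier_of_tendsto' h1 (E := S)
    (by rw [hS.frontier_eq]; simp)
  have h3 : ∀ t, (P.map fun ω => occupation (Y t ω)) S =
      P {ω | occupationWord M N (occupation (Y t ω)) ∈ A} := fun t =>
    Measure.map_apply_of_aemeasurable (hconv.forall_aemeasurable t) hS.1.measurableSet
  have h4 : μ.real S = ∑ η ∈ A, treeFormula α η := by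
    have h5 : S = ⋃ η ∈ A, {ζ | ∀ i : Fin (2 * M + 2 * N + 1), ζ i = η i} := by
      ext ζ
      simp only [S, Set.mem_preimage, Finset.mem_coe, Set.mem_iUnion, Set.mem_ofPred_eq,
        exists_prop]
      constructor
      · intro h
        exact ⟨_, h, fun i => rfl⟩
      · rintro ⟨η, hη, h⟩
        rwa [show occupationWord M N ζ = η from funext h]
    rw [h5, measureReal_biUnion_finset]
    · refine Finset.sum_congr rfl fun η _ => ?_
      rw [hmat _ (bidiagonalAnsatz α hα), bidiagonalAnsatz_bracket]
    · intro η _ η' _ hne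
      rw [Function.onFun, Set.disjoint_left]
      intro ζ h h'
      exact hne (funext fun i => (h i).symm.trans (h' i))
    · intro η _
      have : {ζ : ℕ → Fin 2 | ∀ i : Fin (2 * M + 2 * N + 1), ζ i = η i} =
          occupationWord M N ⁻¹' {η} := by
        ext ζ
        exact ⟨fun h => funext h, fun h i => congrFun h i⟩
      rw [this]
      exact ((isClopen_discrete _).preimage (continuous_occupationWord M N)).1.measurableSet
  rw [← h4]
  have h6 := (ENNReal.tendsto_toReal (measure_ne_top μ S)).comp
    (by simpa [h3] using h2 : Tendsto (fun t =>
      P {ω | occupationWord M N (occupation (Y t ω)) ∈ A}) atTop (𝓝 (μ S)))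
  exact h6

theorem measurable_occupation : Measurable occupation := by
  have : DiscreteMeasurableSpace Color := ⟨fun _ => trivial⟩
  refine measurable_pi_lambda _ fun i => ?_
  exact (Measurable.of_discrete (f := fun c : Color => if c = Color.hole then (0 : Fin 2) else 1)).comp
    (measurable_pi_apply i)

/-! ### Class counts in terms of block sums -/

theorem twoShockInit_eq_hole {M N i : ℕ} (hi : 2 * M + 2 * N + 1 ≤ i) :
    twoShockInit M N i = Color.hole := by
  simp only [twoShockInit]
  rw [if_neg (by omega), if_neg (by omega), if_neg (by omega)]

theorem twoShockInit'_eq_hole {M N i : ℕ} (hi : 2 * M + 2 * N + 1 ≤ i) :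
    twoShockInit' M N i = Color.hole := by
  simp only [twoShockInit']
  rw [if_neg (by omega), if_neg (by omega)]

/-- The holes fill the window `[M, M + 2N + 1)` from the left, and only its first `N + 1` sites are
counted; hence the minimum with `N + 1`. -/
theorem card_filter_window (M N : ℕ) (ζ : Config) :
    ((Finset.Ico M (M + N + 1)).filter fun j =>
      act Color.first (shockWord M N).reverse ζ j = Color.hole).card =
      min (wordHoles M N (occupationWord M N (occupation ζ))) (N + 1) := by
  have : ((Finset.Ico M (M + N + 1)).filter fun j =>
      act Color.first (shockWord M N).reverse ζ j = Color.hole) =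
      Finset.Ico M (M + min (windowHoles M N ζ) (N + 1)) := by
    ext j
    rw [Finset.mem_filter, Finset.mem_Ico, Finset.mem_Ico]
    by_cases hj : M ≤ j ∧ j < M + N + 1
    · rw [act_reverse_shockWord_eq_hole_iff M N ζ hj.1 (by omega)]
      omega
    · omega
  rw [this, Nat.card_Ico, windowHoles_eq]
  omega

theorem card_filter_middle (M N : ℕ) (ζ : Config) :
    (({M + N} : Finset ℕ).filter fun j =>
      act Color.first (shockWord M N).reverse ζ j = Color.hole).card = 0 ↔
      ¬N < wordHoles M N (occupationWord M N (occupation ζ)) := by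
  rw [Finset.card_eq_zero, Finset.filter_eq_empty_iff, ← windowHoles_eq]
  simp only [Finset.mem_singleton, forall_eq]
  rw [act_reverse_shockWord_eq_hole_iff M N ζ (by omega) (by omega), Nat.add_lt_add_iff_left]

theorem secondClassPosition_pos_iff (η : Config) :
    0 < secondClassPosition η ↔ ¬{i | η i = Color.second}.encard = (0 : ℕ) := by
  rw [Nat.cast_zero, Set.encard_eq_zero, ← Ne, ← Set.nonempty_iff_ne_empty, secondClassPosition]
  split_ifs with h
  · exact ⟨fun _ => h, fun _ => by positivity⟩
  · exact ⟨fun h' => by omega, fun h' => absurd h' h⟩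

theorem countRight_one (c : Color) (η : Config) : countRight c 1 η = {i | η i = c}.encard := by
  simp [countRight]

end HalfLineTASEP
end

/-! ### Proof of the theorem -/

open HalfLineTASEP
theorem theorem4p10 (α : ℝ) (hα : 1 / 2 < α)
    {Ω₀ : Type*} [MeasurableSpace Ω₀] (P₀ : Measure Ω₀) [IsProbabilityMeasure P₀]
    (ηstep : ℝ≥0 → Ω₀ → Config) (hηstep : IsTASEP P₀ α stepInit ηstep)
    (hconj : ConvergesToMatrixProduct P₀ α ηstep)
    (M N : ℕ) (hM : 0 < M) (hN : 0 < N)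
    {Ω₁ : Type*} [MeasurableSpace Ω₁] (P₁ : Measure Ω₁) [IsProbabilityMeasure P₁]
    (ξ : ℝ≥0 → Ω₁ → Config) (hξ : IsTASEP P₁ α (twoShockInit M N) ξ)
    {Ω₂ : Type*} [MeasurableSpace Ω₂] (P₂ : Measure Ω₂) [IsProbabilityMeasure P₂]
    (ξ' : ℝ≥0 → Ω₂ → Config) (hξ' : IsTASEP P₂ α (twoShockInit' M N) ξ') :
    Tendsto (fun t => P₁.real {ω | 0 < secondClassPosition (ξ t ω)}) atTop
      (𝓝 ((∑ m ∈ Finset.range N, ∑ n ∈ Finset.Icc 0 (M + N - m),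
            ∑ η ∈ wordClass M N m n, treeFormula α η) +
          (∑ m ∈ Finset.Icc N (M + N), ∑ n ∈ Finset.Icc 0 M,
            ∑ η ∈ wordClass M N m n, treeFormula α η))) ∧
    ∀ s ≤ N, Tendsto (fun t => P₂.real {ω | countRight Color.third 1 (ξ' t ω) = s}) atTop
      (𝓝 ((∑ n ∈ Finset.Icc 1 s,
            ∑ η ∈ wordClass M N (N - n) (M + N + 1 - s + n), treeFormula α η) +
          (∑ m ∈ Finset.Icc N (M + N),
            ∑ η ∈ wordClass M N m (M + N + 1 - s), treeFormula α η))) := by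
  have hα0 : 0 < α := by linarith
  constructor
  · rw [← sum_filter_wordHoles_lt]
    refine (tendsto_real_occupationWord hα0 hconj M N _).congr fun t => ?_
    have key := real_encard_eq_real_card hα0 hξ hηstep classify_monotone
      (by simp [classify]) (act_shockWord_twoShockInit M N) (c := Color.second) (by decide)
      (l := 2 * M + 2 * N + 1) (fun i hi => by rw [twoShockInit_eq_hole hi]; decide)
      -- The second class particle is the one of color `M + N + 1`, dual to site `M + N`.
      (J := {M + N}) (fun d => by
        simp only [Finset.mem_singleton, exists_eq_left, classify]
        split_ifs <;> simp <;> omega) 0 t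
    simp only [card_filter_middle] at key
    have m1 : MeasurableSet {ω | {i | ξ t ω i = Color.second}.encard = (0 : ℕ)} := by
      have : {ω | {i | ξ t ω i = Color.second}.encard = (0 : ℕ)} =
          ⋂ i, (fun ω => ξ t ω i) ⁻¹' {Color.second}ᶜ := by
        ext ω
        simp [Set.eq_empty_iff_forall_notMem]
      rw [this]
      exact MeasurableSet.iInter fun i =>
        ((measurable_pi_apply i).comp (hξ.measurable t)) trivial
    have m0 : MeasurableSet
        {ω | N < wordHoles M N (occupationWord M N (occupation (ηstep t ω)))} :=
      ((continuous_occupationWord M N).measurable.comp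
        (measurable_occupation.comp (hηstep.measurable t)))
        (Set.toFinite {η | N < wordHoles M N η}).measurableSet
    simp only [secondClassPosition_pos_iff, Finset.mem_filter, Finset.mem_univ, true_and]
    -- Duality compares the events that no second class particle is left; the claim concerns the
    -- complements.
    have e1 := probReal_compl_eq_one_sub (μ := P₁) m1
    have e0 := probReal_compl_eq_one_sub (μ := P₀) m0
    have e2 : P₀.real {ω | ¬N < wordHoles M N (occupationWord M N (occupation (ηstep t ω)))} = 1 -
      P₀.real {ω | N < wordHoles M N (occupationWord M N (occupation (ηstep t ω)))} := e0
    have e3 : P₁.real {ω | ¬{i | ξ t ω i = Color.second}.encard = (0 : ℕ)} =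
      1 - P₁.real {ω | {i | ξ t ω i = Color.second}.encard = (0 : ℕ)} := e1
    linarith
  · intro s hs
    rw [← sum_filter_wordHoles_eq M N hs]
    refine (tendsto_real_occupationWord hα0 hconj M N _).congr fun t => ?_
    have key := real_encard_eq_real_card hα0 hξ' hηstep classify_monotone
      (by simp [classify]) (act_shockWord_twoShockInit' M N) (c := Color.third) (by decide)
      (l := 2 * M + 2 * N + 1) (fun i hi => by rw [twoShockInit'_eq_hole hi]; decide)
      -- The third class consists of the colors `M + 1` to `M + N + 1`.
      (J := Finset.Ico M (M + N + 1)) (fun d => by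
        simp only [Finset.mem_Ico, classify]
        constructor
        · split_ifs <;> simp
          exact ⟨d - 1, by omega⟩
        · rintro ⟨j, hj, rfl⟩
          rw [if_neg (by omega), if_neg (by omega), if_pos (by omega)]) s t
    simp only [card_filter_window] at key
    simp only [countRight_one, key, Finset.mem_filter, Finset.mem_univ, true_and]
    congr 1
    ext ω
    simp only [Set.mem_ofPred_eq]
    -- The cap `N + 1` from `card_filter_window` is harmless because `s ≤ N`.
    omega
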